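/- Let $d\ge 1$ and let $X_1,X_2,\dots$ be a sequence of zero-mean, uniformly bounded $\mathbb R^d$-valued random vectors on a probability space $(\Omega,\mathcal F,\mathbb P)$. Let $\mathcal F_j=\sigma(X_1,\dots,X_j)$, $\mathcal F_{j,\infty}=\sigma(X_k: k\ge j)$, and $$\alpha(k)=\sup\{|\mathbb P(A\cap B)-\mathbb P(A)\mathbb P(B)|: j\ge1,\ A\in\mathcal F_j,\ B\in\mathcal F_{j+k,\infty}\},$$ $$\phi(k)=\sup\{|\mathbb P(B\mid A)-\mathbb P(B)|: j\ge1,\ A\in\mathcal F_j,\ B\in\mathcal F_{j+k,\infty},\ \mathbb P(A)>0\}.$$ Put $S_n=\sum_{k=1}^n (X_k-\mathbb E[X_k])$, $S_{n,m}=\sum_{j=n}^m X_j$ and $s_n=\min_{|u|=1}\mathrm{Cov}(S_n)u\cdot u$. Assume that: (a) there are $C>0$ and $\delta\in(0,1)$ with $\alpha(n)\le C\delta^n$ for all $n\ge1$, and there is $n_0\ge 1$ with $\phi(n_0)<\tfrac12$; (b) there are constants $C_1,C_2\ge1$ such that for all $1\le n\le m$ with $\|S_{n,m}\|_{L^2}\ge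 C_1$, $$\max_{|u|=1}\mathrm{Cov}(S_{n,m})u\cdot u\le C_2\min_{|u|=1}\mathrm{Cov}(S_{n,m})u\cdot u;$$ (c) $\lim_{n\to\infty}s_n=\infty$. Then there are constants $A_1,A_2>0$ and nonempty disjoint sets $I_j=\{a_j,a_j+1,\dots,b_j\}$, $j=1,2,\dots$, with $b_{j-1}<a_j$ for all $j\ge2$ and with union $\{1,2,\dots\}$, such that for every $j\geq 1$ and every unit vector $u\in\mathbb R^d$ $$A_1\le\Big\|\sum_{k\in I_j}X_k\cdot u\Big\|_{L^2}\le\max_{m\in I_j}\Big\|\sum_{k=a_j}^m X_k\cdot u\Big\|_{L^2}\le A_2 .$$ Moreover, let $k_n=\max\{k\ge 1: b_k\le n\}$ (with $k_n=0$ if $n<b_1$) and $\Xi_j=\sum_{k\in I_j}X_k$. Then: (i) there is a constant $c>0$ such that $\big\|\sum_{k=a}^{b_j}X_k\big\|_{L^2}\le c$ for all $j\ge1$ and all $a\in I_j$; (ii) there are constants $R_1,R_2>0$ such that for all sufficiently large $n$ and all unit vectors $u$, $$R_1k_n\le \mathrm{Var}(S_n\cdot u)=\mathrm{Cov}(S_n)u\cdot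 u\le R_2k_n;$$ (iii) for every $\varepsilon>0$, $$\Big|S_n-\sum_{j=1}^{k_n}\Xi_j\Big|=o(s_n^{\varepsilon})\quad\text{as } n\to\infty,\ \mathbb P\text{-almost surely}.$$ -/

import Mathlib

open MeasureTheory ProbabilityTheory Filter

namespace BlockASIP

noncomputable section

variable {Ω : Type*} {d : ℕ}

/-! Sequences `X₁, X₂, …` are functions on `ℕ`; the value at index `0` is never used. -/

/-- The σ-algebra generated by `X₁, …, X_j`. -/
abbrev pastSigma (X : ℕ → Ω → EuclideanSpace ℝ (Fin d)) (j : ℕ) : MeasurableSpace Ω :=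
  ⨆ k ∈ Set.Icc 1 j, MeasurableSpace.comap (X k) inferInstance

/-- The σ-algebra generated by all `X_k` with `k ≥ j`. -/
abbrev futureSigma (X : ℕ → Ω → EuclideanSpace ℝ (Fin d)) (j : ℕ) : MeasurableSpace Ω :=
  ⨆ k ∈ Set.Ici j, MeasurableSpace.comap (X k) inferInstance

variable [MeasurableSpace Ω]

/-- The strong mixing coefficient `α(k)`. -/
def alphaCoeff (P : Measure Ω) (X : ℕ → Ω → EuclideanSpace ℝ (Fin d)) (k : ℕ) : ℝ :=
  sSup {x : ℝ | ∃ j : ℕ, 1 ≤ j ∧ ∃ A B : Set Ω,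
    MeasurableSet[pastSigma X j] A ∧ MeasurableSet[futureSigma X (j + k)] B ∧
    x = |P.real (A ∩ B) - P.real A * P.real B|}

/-- The mixing coefficient `φ(k)`. -/
def phiCoeff (P : Measure Ω) (X : ℕ → Ω → EuclideanSpace ℝ (Fin d)) (k : ℕ) : ℝ :=
  sSup {x : ℝ | ∃ j : ℕ, 1 ≤ j ∧ ∃ A B : Set Ω,
    MeasurableSet[pastSigma X j] A ∧ MeasurableSet[futureSigma X (j + k)] B ∧
    0 < P A ∧ x = |(ProbabilityTheory.cond P A).real B - P.real B|}

/-- The centred partial sum `S_n = ∑_{k=1}^n (X_k - E X_k)`. -/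
def partialSum (P : Measure Ω) (X : ℕ → Ω → EuclideanSpace ℝ (Fin d)) (n : ℕ) (ω : Ω) :
    EuclideanSpace ℝ (Fin d) :=
  ∑ k ∈ Finset.Icc 1 n, (X k ω - ∫ ω', X k ω' ∂P)

/-- The covariance matrix of a random vector. -/
def covMatrix (P : Measure Ω) (Y : Ω → EuclideanSpace ℝ (Fin d)) : Matrix (Fin d) (Fin d) ℝ :=
  Matrix.of fun i j => covariance (fun ω => Y ω i) (fun ω => Y ω j) P

end

noncomputable section

variable {Ω : Type*} {d : ℕ}

/-- The sum `S_{n,m} = ∑_{j=n}^m X_j`. -/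
def segSum (X : ℕ → Ω → EuclideanSpace ℝ (Fin d)) (n m : ℕ) (ω : Ω) :
    EuclideanSpace ℝ (Fin d) :=
  ∑ j ∈ Finset.Icc n m, X j ω

/-- The quadratic form `V u · u`. -/
def quadForm (V : Matrix (Fin d) (Fin d) ℝ) (u : EuclideanSpace ℝ (Fin d)) : ℝ :=
  inner ℝ (Matrix.toEuclideanLin V u) u

/-- `max_{|u|=1} V u · u` (for `d ≥ 1`; attained by compactness of the sphere). -/
def maxQuad (V : Matrix (Fin d) (Fin d) ℝ) : ℝ :=
  ⨆ u : Metric.sphere (0 : EuclideanSpace ℝ (Fin d)) 1, quadForm V u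

/-- `min_{|u|=1} V u · u` (for `d ≥ 1`; attained by compactness of the sphere). -/
def minQuad (V : Matrix (Fin d) (Fin d) ℝ) : ℝ :=
  ⨅ u : Metric.sphere (0 : EuclideanSpace ℝ (Fin d)) 1, quadForm V u

/-- `s_n = min_{|u|=1} Cov(S_n) u · u`. -/
def minVar [MeasurableSpace Ω] (P : Measure Ω) (X : ℕ → Ω → EuclideanSpace ℝ (Fin d))
    (n : ℕ) : ℝ :=
  minQuad (covMatrix P (partialSum P X n))

/-- There are `C₁, C₂ ≥ 1` such that whenever `‖S_{n,m}‖_{L²} ≥ C₁`, the largest eigenvalue of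
`Cov(S_{n,m})` is at most `C₂` times the smallest one. -/
def ComparableEigenvalues [MeasurableSpace Ω] (P : Measure Ω)
    (X : ℕ → Ω → EuclideanSpace ℝ (Fin d)) : Prop :=
  ∃ C₁ C₂ : ℝ, 1 ≤ C₁ ∧ 1 ≤ C₂ ∧ ∀ n m : ℕ, 1 ≤ n → n ≤ m →
    C₁ ≤ lpNorm (segSum X n m) 2 P →
    maxQuad (covMatrix P (segSum X n m)) ≤ C₂ * minQuad (covMatrix P (segSum X n m))

/-- The sets `I_j = {a_j, …, b_j}`, `j = 1, 2, …`, are nonempty, disjoint, listed from left to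
right, and cover the positive integers. -/
def IsBlockPartition (a b : ℕ → ℕ) : Prop :=
  (∀ j, 1 ≤ j → a j ≤ b j) ∧
  (∀ j, 2 ≤ j → b (j - 1) < a j) ∧
  (∀ i j, 1 ≤ i → 1 ≤ j → i ≠ j → Disjoint (Set.Icc (a i) (b i)) (Set.Icc (a j) (b j))) ∧
  (⋃ j ∈ Set.Ici 1, Set.Icc (a j) (b j)) = Set.Ici 1

/-- `k_n = max {k ≥ 1 : b_k ≤ n}`, with value `0` if there is no such `k`. -/
def blockCount (b : ℕ → ℕ) (n : ℕ) : ℕ :=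
  sSup {k : ℕ | 1 ≤ k ∧ b k ≤ n}

end

end BlockASIP

open BlockASIP Asymptotics

/-! Cut greedily: fix a large threshold `A` and close a block as soon as the L² norm of its sum
reaches `A`. Divergence of `minVar` makes every block end. A summand is bounded by `L`, so prefixes
of a block have norm at most `A + L`, and comparability of eigenvalues turns the lower bound `A`
into variance at least `A² / (d C₂)` in every direction.

The crux is that `k` blocks together have variance of order `k`: the covariances between blocks must
sum to a small fraction of `A²`. Strong mixing controls covariances of bounded functions, whereas
block sums are uniformly controlled only in L². The condition `φ(n₀) < 1/2` closes this gap: an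
Ottaviani inequality and a restart at the first passage time (`measureReal_exceedSet_le`,
`measureReal_exceedSet_add_le`) give the maximum over a block geometric tails at a scale
proportional to `A`, hence a fourth moment of order `A⁴`. Truncation then bounds covariances by a
multiple of `A²` times the cube root of the mixing rate (`abs_covariance_le_of_tail`,
`abs_covariance_segSum_le`).

Adjacent blocks have no gap. With `A = ℓ² L` a block has at least `ℓ²` terms, and removing its last
`ℓ` terms changes the sum by at most `A / ℓ` in L² while opening a gap of length `ℓ`. Relative to
`A²` the covariances thus sum to `O(1/ℓ + ρ^ℓ)` (`abs_covariance_blocks_le`), with constants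
independent of `ℓ`, and a large `ℓ` makes this negligible against `1 / (d C₂)`.

For the almost sure statement, the geometric tails and Borel–Cantelli bound the oscillation in block
`j` by a multiple of `log j`, while `minVar` grows at least linearly in the number of blocks. -/

/-! ### Covariance inequalities under strong mixing -/

/-- The layer-cake representation of a bounded function. -/
lemma add_eq_integral_indicator_Iio {T x : ℝ} (hx : |x| ≤ T) :
    ∫ s, (Set.Iio x).indicator (fun _ => (1 : ℝ)) s ∂(volume.restrict (Set.Ioc (-T) T)) = x + T := by
  have h := abs_le.1 hx
  rw [integral_indicator measurableSet_Iio, setIntegral_const, smul_eq_mul, mul_one,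
    measureReal_restrict_apply measurableSet_Iio]
  have : Set.Iio x ∩ Set.Ioc (-T) T = Set.Ioo (-T) x := by
    ext s; simp only [Set.mem_inter_iff, Set.mem_Iio, Set.mem_Ioc, Set.mem_Ioo]
    constructor
    · rintro ⟨h1, h2, -⟩; exact ⟨h2, h1⟩
    · rintro ⟨h1, h2⟩; exact ⟨h2, h1, by linarith⟩
  rw [this, Real.volume_real_Ioo_of_le (by linarith)]
  ring

lemma integral_indicator_Iio_comp {Ω : Type*} [MeasurableSpace Ω] {P : Measure Ω}
    {f : Ω → ℝ} (hf : Measurable f) (s : ℝ) :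
    ∫ ω, (Set.Iio (f ω)).indicator (fun _ => (1 : ℝ)) s ∂P = P.real {ω | s < f ω} := by
  have : (fun ω => (Set.Iio (f ω)).indicator (fun _ => (1 : ℝ)) s)
      = {ω | s < f ω}.indicator (fun _ => (1 : ℝ)) := by
    ext ω; simp [Set.indicator]
  rw [this, integral_indicator (measurableSet_lt measurable_const hf)]
  simp

lemma measurable_indicator_Iio_comp {Ω : Type*} [MeasurableSpace Ω]
    {f : Ω → ℝ} (hf : Measurable f) :
    Measurable fun p : Ω × ℝ => (Set.Iio (f p.1)).indicator (fun _ => (1 : ℝ)) p.2 := by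
  have : (fun p : Ω × ℝ => (Set.Iio (f p.1)).indicator (fun _ => (1 : ℝ)) p.2)
      = {p : Ω × ℝ | p.2 < f p.1}.indicator (fun _ => (1 : ℝ)) := by
    ext p; simp [Set.indicator]
  rw [this]
  exact measurable_const.indicator
    (measurableSet_lt measurable_snd (hf.comp measurable_fst))

lemma norm_indicator_one_le {α : Type*} (s : Set α) (x : α) :
    ‖s.indicator (fun _ => (1 : ℝ)) x‖ ≤ 1 := by
  by_cases h : x ∈ s <;> simp [h]

/-- Covariance inequality for bounded functions, from a bound for events. -/
theorem abs_covariance_le_of_bounded {Ω : Type*} {m₁ m₂ : MeasurableSpace Ω}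
    [mΩ : MeasurableSpace Ω] {P : Measure Ω} [IsProbabilityMeasure P] (hm₁ : m₁ ≤ mΩ)
    (hm₂ : m₂ ≤ mΩ) {α T : ℝ}
    (hα : ∀ A B, MeasurableSet[m₁] A → MeasurableSet[m₂] B →
      |P.real (A ∩ B) - P.real A * P.real B| ≤ α)
    {f g : Ω → ℝ} (hf : Measurable[m₁] f) (hg : Measurable[m₂] g) (hfT : ∀ ω, |f ω| ≤ T)
    (hgT : ∀ ω, |g ω| ≤ T) : |covariance f g P| ≤ 4 * T ^ 2 * α := by
  have hf' : Measurable f := hf.mono hm₁ le_rfl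
  have hg' : Measurable g := hg.mono hm₂ le_rfl
  have hT : 0 ≤ T := by
    obtain ⟨ω⟩ := P.nonempty_of_neZero
    exact (abs_nonneg _).trans (hfT ω)
  have hfL : MemLp f 2 P := MemLp.of_bound hf'.aestronglyMeasurable T (ae_of_all _ hfT)
  have hgL : MemLp g 2 P := MemLp.of_bound hg'.aestronglyMeasurable T (ae_of_all _ hgT)
  have hfi := hfL.integrable one_le_two
  have hgi := hgL.integrable one_le_two
  set ν : Measure ℝ := volume.restrict (Set.Ioc (-T) T) with hν
  set e : ℝ → ℝ → ℝ := fun x s => (Set.Iio x).indicator (fun _ => (1 : ℝ)) s with he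
  -- Adding `T` makes both functions nonnegative without changing the covariance. The layer-cake
  -- formula then yields Hoeffding's identity: the covariance is the integral of `P(f > s, g > t) -
  -- P(f > s) P(g > t)` over a square of side `2T`.
  have hshift : covariance f g P
      = ∫ ω, (f ω + T) * (g ω + T) ∂P - (∫ ω, f ω + T ∂P) * ∫ ω, g ω + T ∂P := by
    rw [← covariance_add_const_left hfi T, ← covariance_add_const_right hgi T]
    exact covariance_eq_sub (hfL.add (memLp_const T)) (hgL.add (memLp_const T))
  have hone : ∀ {h : Ω → ℝ}, Measurable h → (∀ ω, |h ω| ≤ T) →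
      ∫ ω, h ω + T ∂P = ∫ s, P.real {ω | s < h ω} ∂ν := by
    intro h hh hhT
    simp_rw [← fun ω => add_eq_integral_indicator_Iio (hhT ω)]
    rw [integral_integral_swap]
    · simp_rw [integral_indicator_Iio_comp hh]
      rfl
    · exact Integrable.of_bound (measurable_indicator_Iio_comp hh).aestronglyMeasurable 1
        (ae_of_all _ fun p => norm_indicator_one_le _ _)
  have htwo : ∫ ω, (f ω + T) * (g ω + T) ∂P
      = ∫ p : ℝ × ℝ, P.real ({ω | p.1 < f ω} ∩ {ω | p.2 < g ω}) ∂(ν.prod ν) := by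
    have h1 : ∀ ω, (f ω + T) * (g ω + T) = ∫ p : ℝ × ℝ, e (f ω) p.1 * e (g ω) p.2 ∂(ν.prod ν) := by
      intro ω
      rw [integral_prod_mul, add_eq_integral_indicator_Iio (hfT ω),
        add_eq_integral_indicator_Iio (hgT ω)]
    simp_rw [h1]
    rw [integral_integral_swap]
    · refine integral_congr_ae (ae_of_all _ fun p => ?_)
      have : (fun ω => e (f ω) p.1 * e (g ω) p.2)
          = ({ω | p.1 < f ω} ∩ {ω | p.2 < g ω}).indicator (fun _ => (1 : ℝ)) := by
        ext ω
        by_cases h1 : p.1 < f ω <;> by_cases h2 : p.2 < g ω <;> simp [he, Set.indicator, h1, h2]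
      simp only [this]
      rw [integral_indicator ((measurableSet_lt measurable_const hf').inter
        (measurableSet_lt measurable_const hg'))]
      simp
    · refine Integrable.of_bound (Measurable.aestronglyMeasurable ?_) 1 (ae_of_all _ fun p => ?_)
      · exact ((measurable_indicator_Iio_comp hf').comp
          (measurable_fst.prodMk (measurable_fst.comp measurable_snd))).mul
          ((measurable_indicator_Iio_comp hg').comp
          (measurable_fst.prodMk (measurable_snd.comp measurable_snd)))
      · simp only [Function.uncurry, norm_mul]
        exact mul_le_one₀ (norm_indicator_one_le _ _) (norm_nonneg _) (norm_indicator_one_le _ _)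
  rw [hshift, htwo, hone hf' hfT, hone hg' hgT, ← integral_prod_mul]
  have mP : ∀ {h : Ω → ℝ}, Measurable h → Measurable fun s => P.real {ω | s < h ω} := by
    intro h hh
    have : Antitone fun s => P.real {ω | s < h ω} := fun s t hst =>
      measureReal_mono fun ω (hω : t < h ω) => lt_of_le_of_lt hst hω
    exact this.measurable
  have mP2 : Measurable fun p : ℝ × ℝ => P.real ({ω | p.1 < f ω} ∩ {ω | p.2 < g ω}) := by
    have hs : MeasurableSet {q : (ℝ × ℝ) × Ω | q.1.1 < f q.2 ∧ q.1.2 < g q.2} :=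
      (measurableSet_lt (measurable_fst.comp measurable_fst) (hf'.comp measurable_snd)).inter
        (measurableSet_lt (measurable_snd.comp measurable_fst) (hg'.comp measurable_snd))
    exact (measurable_measure_prodMk_left (ν := P) hs).ennreal_toReal
  rw [← integral_sub]
  · have hb := norm_integral_le_of_norm_le_const (μ := ν.prod ν) (C := α)
      (f := fun p : ℝ × ℝ => P.real ({ω | p.1 < f ω} ∩ {ω | p.2 < g ω})
        - P.real {ω | p.1 < f ω} * P.real {ω | p.2 < g ω}) (ae_of_all _ fun p =>
        hα _ _ (measurableSet_lt measurable_const hf) (measurableSet_lt measurable_const hg))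
    refine hb.trans (le_of_eq ?_)
    have : (ν.prod ν).real Set.univ = (2 * T) * (2 * T) := by
      rw [← Set.univ_prod_univ, measureReal_prod_prod, hν, measureReal_restrict_apply_univ,
        Real.volume_real_Ioc_of_le (by linarith)]
      ring
    rw [this]; ring
  · exact Integrable.of_bound mP2.aestronglyMeasurable 1 (ae_of_all _ fun p => by
      rw [Real.norm_of_nonneg measureReal_nonneg]; exact measureReal_le_one)
  · refine Integrable.of_bound (((mP hf').comp measurable_fst).mul
      ((mP hg').comp measurable_snd)).aestronglyMeasurable 1 (ae_of_all _ fun p => ?_)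
    rw [norm_mul, Real.norm_of_nonneg measureReal_nonneg, Real.norm_of_nonneg measureReal_nonneg]
    exact mul_le_one₀ measureReal_le_one measureReal_nonneg measureReal_le_one

/-- The constant `∑ (k + 1)⁴ (3/4)ᵏ`. -/
noncomputable def geomMoment : ℝ := ∑' k : ℕ, ((k : ℝ) + 1) ^ 4 * (3 / 4 : ℝ) ^ k

lemma summable_geomMoment : Summable fun k : ℕ => ((k : ℝ) + 1) ^ 4 * (3 / 4 : ℝ) ^ k := by
  have h := (summable_nat_add_iff 1).2
    (summable_pow_mul_geometric_of_norm_lt_one 4 (r := (3 / 4 : ℝ)) (by norm_num))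
  refine (h.mul_left (4 / 3)).congr fun k => ?_
  push_cast
  ring

lemma geomMoment_nonneg : 0 ≤ geomMoment := tsum_nonneg fun k => by positivity

/-- Geometric tails bound the fourth moment. -/
theorem integral_pow_four_le {Ω : Type*} [MeasurableSpace Ω] {P : Measure Ω}
    [IsProbabilityMeasure P] {f : Ω → ℝ} (hf : Measurable f) {B W : ℝ} (hW : 0 < W)
    (hB : ∀ᵐ ω ∂P, |f ω| ≤ B)
    (htail : ∀ k : ℕ, P.real {ω | k * W < |f ω|} ≤ (3 / 4) ^ k) :
    ∫ ω, f ω ^ 4 ∂P ≤ geomMoment * W ^ 4 := by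
  obtain ⟨K, hK⟩ := exists_nat_ge (B / W)
  rw [div_le_iff₀ hW] at hK
  have hms : ∀ k : ℕ, MeasurableSet {ω | k * W < |f ω|} := fun k =>
    measurableSet_lt measurable_const hf.abs
  set G : Ω → ℝ := fun ω => ∑ k ∈ Finset.range K,
    {ω | k * W < |f ω|}.indicator (fun _ => ((k + 1) * W) ^ 4) ω with hG
  have hGi : ∀ k ∈ Finset.range K, Integrable
      ({ω | (k : ℝ) * W < |f ω|}.indicator (fun _ => (((k : ℝ) + 1) * W) ^ 4)) P := fun k _ =>
    (integrable_const _).indicator (hms k)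
  have hle : ∀ᵐ ω ∂P, f ω ^ 4 ≤ G ω := by
    filter_upwards [hB] with ω hω
    have hnn : ∀ k ∈ Finset.range K,
        0 ≤ {ω | (k : ℝ) * W < |f ω|}.indicator (fun _ => (((k : ℝ) + 1) * W) ^ 4) ω := fun k _ =>
      Set.indicator_nonneg (fun _ _ => by positivity) _
    rcases eq_or_lt_of_le (abs_nonneg (f ω)) with h0 | h0
    · rw [abs_eq_zero.1 h0.symm]
      simpa using Finset.sum_nonneg hnn
    · obtain ⟨k, hk1, hk2⟩ : ∃ k : ℕ, k * W < |f ω| ∧ |f ω| ≤ (k + 1) * W := by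
        have hpos : 0 < |f ω| / W := by positivity
        have hc := Nat.ceil_pos.2 hpos
        refine ⟨⌈|f ω| / W⌉₊ - 1, ?_, ?_⟩
        · rw [← lt_div_iff₀ hW]
          exact Nat.lt_ceil.1 (by omega)
        · rw [← div_le_iff₀ hW]
          have := Nat.le_ceil (|f ω| / W)
          have h2 : ((⌈|f ω| / W⌉₊ - 1 : ℕ) : ℝ) + 1 = ⌈|f ω| / W⌉₊ := by
            exact_mod_cast Nat.sub_add_cancel hc
          rwa [h2]
      have hkK : k ∈ Finset.range K := by
        rw [Finset.mem_range]
        have : (k : ℝ) * W < K * W := by linarith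
        exact_mod_cast lt_of_mul_lt_mul_right this hW.le
      refine le_trans ?_ (Finset.single_le_sum hnn hkK)
      rw [Set.indicator_of_mem (by exact hk1), ← (show Even 4 by decide).pow_abs]
      exact pow_le_pow_left₀ (abs_nonneg _) hk2 4
  have hf4 : Integrable (fun ω => f ω ^ 4) P :=
    Integrable.of_bound (hf.pow_const 4).aestronglyMeasurable (B ^ 4) (by
      filter_upwards [hB] with ω hω
      rw [norm_pow]
      exact pow_le_pow_left₀ (norm_nonneg _) hω 4)
  calc ∫ ω, f ω ^ 4 ∂P ≤ ∫ ω, G ω ∂P :=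
        integral_mono_ae hf4 (integrable_finsetSum _ hGi) hle
    _ = ∑ k ∈ Finset.range K, P.real {ω | k * W < |f ω|} * ((k + 1) * W) ^ 4 := by
        rw [hG, integral_finsetSum _ hGi]
        refine Finset.sum_congr rfl fun k _ => ?_
        rw [integral_indicator (hms k), setIntegral_const, smul_eq_mul]
    _ ≤ ∑ k ∈ Finset.range K, (((k : ℝ) + 1) ^ 4 * (3 / 4 : ℝ) ^ k) * W ^ 4 := by
        refine Finset.sum_le_sum fun k _ => ?_
        have := mul_le_mul_of_nonneg_right (htail k)
          (show 0 ≤ (((k : ℝ) + 1) * W) ^ 4 by positivity)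
        refine this.trans (le_of_eq (by ring))
    _ ≤ geomMoment * W ^ 4 := by
        rw [← Finset.sum_mul]
        refine mul_le_mul_of_nonneg_right ?_ (by positivity)
        exact summable_geomMoment.sum_le_tsum _ fun k _ => by positivity

/-- Covariance bound by the arithmetic-geometric mean inequality. -/
lemma abs_covariance_le_of_variance_le {Ω : Type*} [MeasurableSpace Ω] {P : Measure Ω}
    [IsProbabilityMeasure P] {f g : Ω → ℝ} (hf : MemLp f 2 P) (hg : MemLp g 2 P) {η V V' : ℝ}
    (hη : 0 < η) (hfV : variance f P ≤ V) (hgV : variance g P ≤ η ^ 2 * V') :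
    |covariance f g P| ≤ η * (V + V') / 2 := by
  -- Nonnegativity of the variances of `η f ± g` gives `2η |Cov(f, g)| ≤ η² Var f + Var g`.
  have h1 := variance_nonneg (η • f + g) P
  have h2 := variance_nonneg (η • f - g) P
  rw [variance_add (hf.const_smul η) hg, variance_smul, covariance_smul_left] at h1
  rw [variance_sub (hf.const_smul η) hg, variance_smul, covariance_smul_left] at h2
  have h3 : η ^ 2 * variance f P ≤ η ^ 2 * V := by gcongr
  have h4 : η * |covariance f g P| ≤ η * (η * (V + V') / 2) := by
    rcases abs_cases (covariance f g P) with ⟨h, -⟩ | ⟨h, -⟩ <;> rw [h] <;> nlinarith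
  exact le_of_mul_le_mul_left h4 hη

/-- Covariance inequality for functions with geometric tails under strong mixing. -/
theorem abs_covariance_le_of_tail {Ω : Type*} {m₁ m₂ : MeasurableSpace Ω}
    [mΩ : MeasurableSpace Ω] {P : Measure Ω} [IsProbabilityMeasure P] (hm₁ : m₁ ≤ mΩ)
    (hm₂ : m₂ ≤ mΩ) {η : ℝ} (hη : 0 < η)
    (hα : ∀ A B, MeasurableSet[m₁] A → MeasurableSet[m₂] B →
      |P.real (A ∩ B) - P.real A * P.real B| ≤ η ^ 3)
    {f g : Ω → ℝ} (hf : Measurable[m₁] f) (hg : Measurable[m₂] g) {B W : ℝ} (hW : 0 < W)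
    (hfB : ∀ᵐ ω ∂P, |f ω| ≤ B) (hgB : ∀ᵐ ω ∂P, |g ω| ≤ B)
    (hf2 : ∫ ω, f ω ^ 2 ∂P ≤ W ^ 2) (hg2 : ∫ ω, g ω ^ 2 ∂P ≤ W ^ 2)
    (hft : ∀ k : ℕ, P.real {ω | k * W < |f ω|} ≤ (3 / 4) ^ k)
    (hgt : ∀ k : ℕ, P.real {ω | k * W < |g ω|} ≤ (3 / 4) ^ k) :
    |covariance f g P| ≤ (5 + geomMoment) * W ^ 2 * η := by
  have hf' : Measurable f := hf.mono hm₁ le_rfl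
  have hg' : Measurable g := hg.mono hm₂ le_rfl
  -- This level balances the errors: the truncated parts contribute `4 T² η³ = 4 W² η`, and each
  -- remainder has variance at most `E h⁴ / T²`, of order `η² W²`.
  set T : ℝ := W / η with hT
  have hTpos : 0 < T := by positivity
  set τ : ℝ → ℝ := (Set.Icc (-T) T).indicator id with hτ
  have hτm : Measurable τ := measurable_id.indicator measurableSet_Icc
  have hτT : ∀ x, |τ x| ≤ T := by
    intro x
    by_cases h : x ∈ Set.Icc (-T) T
    · rw [hτ, Set.indicator_of_mem h]; exact abs_le.2 h
    · rw [hτ, Set.indicator_of_notMem h]; simpa using hTpos.le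
  have hτle : ∀ x, |τ x| ≤ |x| := by
    intro x
    by_cases h : x ∈ Set.Icc (-T) T
    · rw [hτ, Set.indicator_of_mem h]; rfl
    · rw [hτ, Set.indicator_of_notMem h]; simp
  have hrem : ∀ x, (x - τ x) ^ 2 ≤ x ^ 4 / T ^ 2 := by
    intro x
    by_cases h : x ∈ Set.Icc (-T) T
    · rw [hτ, Set.indicator_of_mem h]; simp; positivity
    · rw [hτ, Set.indicator_of_notMem h, sub_zero, le_div_iff₀ (by positivity)]
      have : T ^ 2 ≤ x ^ 2 := by
        rw [sq_le_sq, abs_of_pos hTpos]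
        by_contra! h'
        exact h ⟨(abs_lt.1 h').1.le, (abs_lt.1 h').2.le⟩
      nlinarith [sq_nonneg x]
  have memL : ∀ {h : Ω → ℝ}, Measurable h → (∀ᵐ ω ∂P, |h ω| ≤ B) → MemLp h 2 P := fun hh hb =>
    MemLp.of_bound hh.aestronglyMeasurable B hb
  have memτ : ∀ {h : Ω → ℝ}, Measurable h → MemLp (fun ω => τ (h ω)) 2 P := fun hh =>
    MemLp.of_bound (hτm.comp hh).aestronglyMeasurable T (ae_of_all _ fun ω => hτT _)
  have varle : ∀ {h : Ω → ℝ}, Measurable h → variance h P ≤ ∫ ω, h ω ^ 2 ∂P := fun hh =>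
    variance_le_expectation_sq hh.aestronglyMeasurable
  have varrem : ∀ {h : Ω → ℝ}, Measurable h → (∀ᵐ ω ∂P, |h ω| ≤ B) →
      (∀ k : ℕ, P.real {ω | k * W < |h ω|} ≤ (3 / 4) ^ k) →
      variance (fun ω => h ω - τ (h ω)) P ≤ η ^ 2 * (geomMoment * W ^ 2) := by
    intro h hh hb ht
    refine (varle (hh.sub (hτm.comp hh))).trans ?_
    have hi : Integrable (fun ω => h ω ^ 4 / T ^ 2) P := by
      refine Integrable.div_const (Integrable.of_bound (hh.pow_const 4).aestronglyMeasurable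
        (B ^ 4) ?_) _
      filter_upwards [hb] with ω hω
      rw [norm_pow]
      exact pow_le_pow_left₀ (norm_nonneg _) hω 4
    calc ∫ ω, (h ω - τ (h ω)) ^ 2 ∂P ≤ ∫ ω, h ω ^ 4 / T ^ 2 ∂P :=
          integral_mono_of_nonneg (ae_of_all _ fun ω => sq_nonneg _) hi
            (ae_of_all _ fun ω => hrem _)
      _ ≤ geomMoment * W ^ 4 / T ^ 2 := by
          rw [integral_div]
          gcongr
          exact integral_pow_four_le hh hW hb ht
      _ = η ^ 2 * (geomMoment * W ^ 2) := by
          rw [hT]; field_simp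
  have hmain := abs_covariance_le_of_bounded hm₁ hm₂ hα (hτm.comp hf) (hτm.comp hg)
    (fun ω => hτT _) (fun ω => hτT _)
  have hvarτ : variance (fun ω => τ (f ω)) P ≤ W ^ 2 := by
    refine (varle (hτm.comp hf')).trans (le_trans ?_ hf2)
    refine integral_mono_of_nonneg (ae_of_all _ fun ω => sq_nonneg _) (memL hf' hfB).integrable_sq
      (ae_of_all _ fun ω => sq_le_sq.2 (hτle _))
  -- The decomposition is `Cov(f, g) = Cov(τf, τg) + Cov(τf, g - τg) + Cov(f - τf, g)`; the last two
  -- terms are handled by the weighted mean inequality.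
  have h1 := abs_covariance_le_of_variance_le (memτ hf') ((memL hg' hgB).sub (memτ hg')) hη hvarτ
    (varrem hg' hgB hgt)
  have h2 := abs_covariance_le_of_variance_le (memL hg' hgB) ((memL hf' hfB).sub (memτ hf')) hη
    ((varle hg').trans hg2) (varrem hf' hfB hft)
  rw [covariance_sub_right (memτ hf') (memL hg' hgB) (memτ hg')] at h1
  rw [covariance_sub_right (memL hg' hgB) (memL hf' hfB) (memτ hf'), covariance_comm g f,
    covariance_comm g] at h2
  have h3 : 4 * T ^ 2 * η ^ 3 = 4 * W ^ 2 * η := by rw [hT]; field_simp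
  rw [h3] at hmain
  change |covariance (fun ω => τ (f ω)) (fun ω => τ (g ω)) P| ≤ _ at hmain
  rw [abs_le] at h1 h2 hmain ⊢
  constructor <;> nlinarith [h1.1, h1.2, h2.1, h2.2, hmain.1, hmain.2]

/-! ### Maximal inequalities for segment sums under mixing -/

section Mixing

variable {Ω : Type*} {d : ℕ} {X : ℕ → Ω → EuclideanSpace ℝ (Fin d)}

lemma segSum_of_lt {n m : ℕ} (h : m < n) : segSum X n m = 0 := by
  ext1 ω; simp [segSum, Finset.Icc_eq_empty_of_lt h]

lemma segSum_add_segSum {a m r : ℕ} (h₁ : a ≤ m + 1) (h₂ : m ≤ r) (ω : Ω) :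
    segSum X a m ω + segSum X (m + 1) r ω = segSum X a r ω := by
  have := Finset.sum_Ico_consecutive (fun k => X k ω) h₁ (show m + 1 ≤ r + 1 by omega)
  simpa only [segSum, ← Finset.Ico_add_one_right_eq_Icc] using this

lemma segSum_succ {a m : ℕ} (h : a ≤ m + 1) (ω : Ω) :
    segSum X a (m + 1) ω = segSum X a m ω + X (m + 1) ω := by
  rw [← segSum_add_segSum h (Nat.le_succ m)]
  simp [segSum]

lemma norm_segSum_le {L : ℝ} {ω : Ω} (hL : ∀ k, 1 ≤ k → ‖X k ω‖ ≤ L) {a b : ℕ} (ha : 1 ≤ a) :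
    ‖segSum X a b ω‖ ≤ ((b + 1 - a : ℕ) : ℝ) * L := by
  have := norm_sum_le_of_le (Finset.Icc a b) (f := fun k => X k ω) (n := fun _ => L)
    fun k hk => hL k (ha.trans (Finset.mem_Icc.1 hk).1)
  simpa [segSum] using this

/-- Fewer than `n` terms lie between the two pieces, so a mixing gap is opened at bounded cost. For
`r < m + n` the second piece is empty and the estimate persists. -/
lemma norm_segSum_sub_le {L : ℝ} {ω : Ω} (hL : ∀ k, 1 ≤ k → ‖X k ω‖ ≤ L) (hL0 : 0 ≤ L)
    {a m r n : ℕ} (hn : 1 ≤ n) (h₁ : a ≤ m + 1) (h₂ : m ≤ r) :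
    ‖segSum X a r ω - segSum X a m ω - segSum X (m + n) r ω‖ ≤ n * L := by
  rw [← segSum_add_segSum h₁ h₂ ω, add_sub_cancel_left]
  have hsub : Finset.Icc (m + n) r ⊆ Finset.Icc (m + 1) r :=
    Finset.Icc_subset_Icc_left (by omega)
  have hs := Finset.sum_sdiff_eq_sub (f := fun k => X k ω) hsub
  have hcard : (Finset.Icc (m + 1) r \ Finset.Icc (m + n) r).card ≤ n := by
    refine (Finset.card_le_card (t := Finset.Ico (m + 1) (m + n)) fun k hk => ?_).trans ?_
    · simp only [Finset.mem_sdiff, Finset.mem_Icc, Finset.mem_Ico] at hk ⊢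
      omega
    · rw [Nat.card_Ico]; omega
  unfold segSum
  rw [← hs]
  refine (norm_sum_le_of_le _ (n := fun _ => L) fun k hk => hL k ?_).trans ?_
  · simp only [Finset.mem_sdiff, Finset.mem_Icc] at hk
    omega
  · rw [Finset.sum_const, nsmul_eq_mul]
    gcongr

lemma measurable_pastSigma {j k : ℕ} (hk : 1 ≤ k) (hkj : k ≤ j) :
    Measurable[pastSigma X j] (X k) :=
  Measurable.mono (comap_measurable (X k))
    (le_iSup₂_of_le (f := fun k (_ : k ∈ Set.Icc 1 j) =>
      MeasurableSpace.comap (X k) inferInstance) k ⟨hk, hkj⟩ le_rfl) le_rfl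

lemma measurable_futureSigma {j k : ℕ} (hjk : j ≤ k) :
    Measurable[futureSigma X j] (X k) :=
  Measurable.mono (comap_measurable (X k))
    (le_iSup₂_of_le (f := fun k (_ : k ∈ Set.Ici j) =>
      MeasurableSpace.comap (X k) inferInstance) k hjk le_rfl) le_rfl

lemma measurable_segSum_past {a b j : ℕ} (ha : 1 ≤ a) (hb : b ≤ j) :
    Measurable[pastSigma X j] (segSum X a b) := by
  unfold segSum
  exact Finset.measurable_fun_sum (m := pastSigma X j) _ fun k hk =>
    measurable_pastSigma (ha.trans (Finset.mem_Icc.1 hk).1) ((Finset.mem_Icc.1 hk).2.trans hb)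

lemma measurable_segSum_future {a b j : ℕ} (ha : j ≤ a) :
    Measurable[futureSigma X j] (segSum X a b) := by
  unfold segSum
  exact Finset.measurable_fun_sum (m := futureSigma X j) _ fun k hk =>
    measurable_futureSigma (ha.trans (Finset.mem_Icc.1 hk).1)

/-- The event that some partial sum of the segment `[a, b]` exceeds `t`. -/
def exceedSet (X : ℕ → Ω → EuclideanSpace ℝ (Fin d)) (a b : ℕ) (t : ℝ) : Set Ω :=
  {ω | ∃ m ∈ Finset.Icc a b, t < ‖segSum X a m ω‖}

/-- The event that the partial sums starting at `a` first exceed `t` at time `m`. -/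
def firstPassage (X : ℕ → Ω → EuclideanSpace ℝ (Fin d)) (a : ℕ) (t : ℝ) (m : ℕ) : Set Ω :=
  {ω | t < ‖segSum X a m ω‖ ∧ ∀ i ∈ Finset.Ico a m, ‖segSum X a i ω‖ ≤ t}

lemma exceedSet_eq_biUnion (a b : ℕ) (t : ℝ) :
    exceedSet X a b t = ⋃ m ∈ Finset.Icc a b, firstPassage X a t m := by
  classical
  ext ω
  simp only [exceedSet, firstPassage, Set.mem_ofPred_eq, Set.mem_iUnion, exists_prop]
  constructor
  · intro h
    refine ⟨Nat.find h, (Nat.find_spec h).1, (Nat.find_spec h).2, fun i hi => ?_⟩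
    have hi' := Finset.mem_Ico.1 hi
    have := Nat.find_min h hi'.2
    have hb := (Finset.mem_Icc.1 (Nat.find_spec h).1).2
    by_contra! hlt
    exact this ⟨Finset.mem_Icc.2 ⟨hi'.1, by omega⟩, hlt⟩
  · rintro ⟨m, hm, h, -⟩
    exact ⟨m, hm, h⟩

lemma pairwiseDisjoint_firstPassage (a b : ℕ) (t : ℝ) :
    ((Finset.Icc a b : Finset ℕ) : Set ℕ).PairwiseDisjoint (firstPassage X a t) := by
  have key : ∀ m ∈ Finset.Icc a b, ∀ n, m < n →
      Disjoint (firstPassage X a t m) (firstPassage X a t n) := by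
    intro m hm n hmn
    refine Set.disjoint_left.2 fun ω h1 h2 => ?_
    exact absurd (h2.2 m (Finset.mem_Ico.2 ⟨(Finset.mem_Icc.1 hm).1, hmn⟩)) (not_le.2 h1.1)
  intro m hm n hn hmn
  rcases lt_or_gt_of_ne hmn with h | h
  · exact key m hm n h
  · exact (key n hn m h).symm

lemma measurableSet_firstPassage {a m : ℕ} (ha : 1 ≤ a) (t : ℝ) :
    MeasurableSet[pastSigma X m] (firstPassage X a t m) := by
  have hs : ∀ i, i ≤ m → Measurable[pastSigma X m] fun ω => ‖segSum X a i ω‖ := fun i hi =>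
    measurable_norm.comp (measurable_segSum_past ha hi)
  have : firstPassage X a t m = {ω | t < ‖segSum X a m ω‖} ∩
      ⋂ i ∈ Finset.Ico a m, {ω | ‖segSum X a i ω‖ ≤ t} := by
    ext ω; simp [firstPassage]
  rw [this]
  refine @MeasurableSet.inter _ (pastSigma X m) _ _ (hs m le_rfl measurableSet_Ioi) ?_
  exact Finset.measurableSet_biInter (m := pastSigma X m) _ fun i hi =>
    hs i (Finset.mem_Ico.1 hi).2.le measurableSet_Iic

lemma measurableSet_exceedSet_future {a b : ℕ} (t : ℝ) :
    MeasurableSet[futureSigma X a] (exceedSet X a b t) := by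
  have : exceedSet X a b t = ⋃ i ∈ Finset.Icc a b, {ω | t < ‖segSum X a i ω‖} := by
    ext ω; simp [exceedSet]
  rw [this]
  exact Finset.measurableSet_biUnion (m := futureSigma X a) _ fun i _ =>
    measurable_norm.comp (measurable_segSum_future le_rfl) measurableSet_Ioi

variable [mΩ : MeasurableSpace Ω] {P : Measure Ω}

/-- All segment sums inside `[a, b]` have `L²` norm at most `D`. -/
def SegBound (P : Measure Ω) (X : ℕ → Ω → EuclideanSpace ℝ (Fin d)) (D : ℝ) (a b : ℕ) : Prop :=
  ∀ i j, a ≤ i → j ≤ b → lpNorm (segSum X i j) 2 P ≤ D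

lemma SegBound.mono {D : ℝ} {a b a' b' : ℕ} (h : SegBound P X D a b) (ha : a ≤ a') (hb : b' ≤ b) :
    SegBound P X D a' b' := fun i j hi hj => h i j (ha.trans hi) (hj.trans hb)

lemma sq_lpNorm_two_eq {E : Type*} [NormedAddCommGroup E] {f : Ω → E}
    (hf : AEStronglyMeasurable f P) : lpNorm f 2 P ^ 2 = ∫ ω, ‖f ω‖ ^ 2 ∂P := by
  rw [lpNorm_eq_integral_norm_rpow_toReal two_ne_zero ENNReal.ofNat_ne_top hf]
  have h0 : 0 ≤ ∫ ω, ‖f ω‖ ^ 2 ∂P := integral_nonneg fun _ => sq_nonneg _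
  simp only [ENNReal.toReal_ofNat, Real.rpow_ofNat]
  rw [← Real.rpow_natCast, ← Real.rpow_mul h0]
  norm_num

lemma pastSigma_le (hmeas : ∀ k, 1 ≤ k → Measurable (X k)) (j : ℕ) : pastSigma X j ≤ mΩ :=
  iSup₂_le fun k hk => (hmeas k hk.1).comap_le

lemma futureSigma_le (hmeas : ∀ k, 1 ≤ k → Measurable (X k)) {j : ℕ} (hj : 1 ≤ j) :
    futureSigma X j ≤ mΩ :=
  iSup₂_le fun k hk => (hmeas k (hj.trans hk)).comap_le

lemma measurable_segSum (hmeas : ∀ k, 1 ≤ k → Measurable (X k)) {a b : ℕ} (ha : 1 ≤ a) :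
    Measurable (segSum X a b) :=
  (measurable_segSum_future le_rfl).mono (futureSigma_le hmeas ha) le_rfl

variable [IsProbabilityMeasure P]

lemma abs_sub_le_alphaCoeff {j k : ℕ} (hj : 1 ≤ j) {A B : Set Ω}
    (hA : MeasurableSet[pastSigma X j] A) (hB : MeasurableSet[futureSigma X (j + k)] B) :
    |P.real (A ∩ B) - P.real A * P.real B| ≤ alphaCoeff P X k := by
  refine le_csSup ⟨1, ?_⟩ ⟨j, hj, A, B, hA, hB, rfl⟩
  rintro x ⟨j, -, A, B, -, -, rfl⟩
  have h1 : P.real (A ∩ B) ≤ 1 := measureReal_le_one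
  have h2 : 0 ≤ P.real (A ∩ B) := measureReal_nonneg
  have h3 : P.real A * P.real B ≤ 1 :=
    mul_le_one₀ measureReal_le_one measureReal_nonneg measureReal_le_one
  have h4 : 0 ≤ P.real A * P.real B := mul_nonneg measureReal_nonneg measureReal_nonneg
  rw [abs_le]; constructor <;> linarith

/-- The error is proportional to `P(A)`, so it can be summed over disjoint first passage events; the
additive error from `alphaCoeff` would accumulate with the length of the segment. -/
lemma abs_sub_le_phiCoeff_mul (hmeas : ∀ k, 1 ≤ k → Measurable (X k)) {j k : ℕ} (hj : 1 ≤ j)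
    {A B : Set Ω} (hA : MeasurableSet[pastSigma X j] A)
    (hB : MeasurableSet[futureSigma X (j + k)] B) :
    |P.real (A ∩ B) - P.real A * P.real B| ≤ phiCoeff P X k * P.real A := by
  have hA' : MeasurableSet A := pastSigma_le hmeas j A hA
  rcases eq_or_ne (P A) 0 with h0 | h0
  · have h1 : P.real A = 0 := by simp [Measure.real, h0]
    have h2 : P.real (A ∩ B) = 0 := by
      simp [Measure.real, measure_mono_null Set.inter_subset_left h0]
    simp [h1, h2]
  · have hpos : 0 < P.real A := ENNReal.toReal_pos h0 (measure_ne_top _ _)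
    have key : |(ProbabilityTheory.cond P A).real B - P.real B| ≤ phiCoeff P X k := by
      refine le_csSup ⟨1, ?_⟩ ⟨j, hj, A, B, hA, hB, pos_iff_ne_zero.2 h0, rfl⟩
      rintro x ⟨j, -, A, B, -, -, hA0, rfl⟩
      have := cond_isProbabilityMeasure (μ := P) hA0.ne'
      have h1 : (ProbabilityTheory.cond P A).real B ≤ 1 := measureReal_le_one
      have h2 : 0 ≤ (ProbabilityTheory.cond P A).real B := measureReal_nonneg
      have h3 : P.real B ≤ 1 := measureReal_le_one
      have h4 : 0 ≤ P.real B := measureReal_nonneg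
      rw [abs_le]; constructor <;> linarith
    rw [measureReal_def, cond_apply hA', ENNReal.toReal_mul, ENNReal.toReal_inv, ← measureReal_def,
      ← measureReal_def] at key
    calc |P.real (A ∩ B) - P.real A * P.real B|
        = |(P.real A)⁻¹ * P.real (A ∩ B) - P.real B| * P.real A := by
          rw [← abs_of_pos hpos, ← abs_mul, abs_of_pos hpos]
          congr 1
          field_simp
      _ ≤ _ := by gcongr

lemma memLp_segSum (hmeas : ∀ k, 1 ≤ k → Measurable (X k)) {L : ℝ}
    (hL : ∀ᵐ ω ∂P, ∀ k, 1 ≤ k → ‖X k ω‖ ≤ L) {a b : ℕ} (ha : 1 ≤ a) (p : ENNReal) :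
    MemLp (segSum X a b) p P := by
  refine MemLp.of_bound (measurable_segSum hmeas ha).aestronglyMeasurable
    (((b + 1 - a : ℕ) : ℝ) * L) ?_
  filter_upwards [hL] with ω hω using norm_segSum_le hω ha

/-- The Chebyshev inequality for segment sums. -/
lemma measureReal_lt_norm_segSum_le (hmeas : ∀ k, 1 ≤ k → Measurable (X k)) {L D y : ℝ}
    (hL : ∀ᵐ ω ∂P, ∀ k, 1 ≤ k → ‖X k ω‖ ≤ L) {a b : ℕ} (ha : 1 ≤ a) (hy : 0 < y)
    (hD : lpNorm (segSum X a b) 2 P ≤ D) :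
    P.real {ω | y < ‖segSum X a b ω‖} ≤ D ^ 2 / y ^ 2 := by
  have hmem := memLp_segSum (P := P) hmeas hL (b := b) ha 2
  have h := mul_meas_ge_le_integral_of_nonneg (μ := P) (f := fun ω => ‖segSum X a b ω‖ ^ 2)
    (ae_of_all _ fun ω => sq_nonneg _) (hmem.integrable_norm_pow two_ne_zero) (y ^ 2)
  rw [← sq_lpNorm_two_eq hmem.1] at h
  rw [le_div_iff₀ (by positivity), mul_comm]
  have h2 : P.real {ω | y < ‖segSum X a b ω‖} ≤ P.real {ω | y ^ 2 ≤ ‖segSum X a b ω‖ ^ 2} :=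
    measureReal_mono fun ω (hω : y < _) => pow_le_pow_left₀ hy.le hω.le 2
  calc _ ≤ y ^ 2 * P.real {ω | y ^ 2 ≤ ‖segSum X a b ω‖ ^ 2} := by gcongr
    _ ≤ lpNorm (segSum X a b) 2 P ^ 2 := h
    _ ≤ D ^ 2 := pow_le_pow_left₀ lpNorm_nonneg hD 2

lemma measureReal_exceedSet (hmeas : ∀ k, 1 ≤ k → Measurable (X k)) {a b : ℕ} (ha : 1 ≤ a)
    (t : ℝ) :
    P.real (exceedSet X a b t) = ∑ m ∈ Finset.Icc a b, P.real (firstPassage X a t m) := by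
  rw [exceedSet_eq_biUnion, measureReal_biUnion_finset (pairwiseDisjoint_firstPassage a b t)
    fun m _ => pastSigma_le hmeas m _ (measurableSet_firstPassage ha t)]

/-- An Ottaviani-type inequality. -/
theorem measureReal_exceedSet_le (hmeas : ∀ k, 1 ≤ k → Measurable (X k)) {L D x : ℝ} {n₀ : ℕ}
    (hL0 : 0 ≤ L) (hL : ∀ᵐ ω ∂P, ∀ k, 1 ≤ k → ‖X k ω‖ ≤ L) (hn₀ : 1 ≤ n₀)
    (hφ : phiCoeff P X n₀ < 1 / 2) (hD : 0 < D) {a b : ℕ} (ha : 1 ≤ a)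
    (hseg : SegBound P X D a b) :
    P.real (exceedSet X a b (x + 2 * D + n₀ * L)) ≤ 4 * P.real {ω | x < ‖segSum X a b ω‖} := by
  set t := x + 2 * D + n₀ * L with ht
  set G : ℕ → Set Ω := fun m => {ω | ‖segSum X (m + n₀) b ω‖ ≤ 2 * D} with hG
  have hGm : ∀ m, MeasurableSet[futureSigma X (m + n₀)] (G m) := fun m =>
    measurable_norm.comp (measurable_segSum_future le_rfl) measurableSet_Iic
  have hGm' : ∀ m, MeasurableSet (G m) := fun m => futureSigma_le hmeas (by omega) _ (hGm m)
  have hF := fun m => measurableSet_firstPassage (X := X) (m := m) ha t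
  have hF' := fun m => pastSigma_le hmeas m _ (hF m)
  -- Chebyshev gives `P(G m) ≥ 3/4`, and conditioning on the past loses less than `1/2`, so at least
  -- `1/4` remains.
  have hquarter : ∀ m ∈ Finset.Icc a b, P.real (firstPassage X a t m)
      ≤ 4 * P.real (firstPassage X a t m ∩ G m) := by
    intro m hm
    have hma := (Finset.mem_Icc.1 hm).1
    have h1 := (abs_le.1 (abs_sub_le_phiCoeff_mul (P := P) hmeas (ha.trans hma) (hF m) (hGm m))).1
    have h2 := measureReal_lt_norm_segSum_le (P := P) hmeas hL (a := m + n₀) (b := b) (by omega)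
      (y := 2 * D) (by positivity) (hseg _ _ (by omega) le_rfl)
    have h3 : {ω | 2 * D < ‖segSum X (m + n₀) b ω‖} = (G m)ᶜ := by
      ext ω; simp [hG]
    rw [h3, probReal_compl_eq_one_sub (hGm' m)] at h2
    have h4 : D ^ 2 / (2 * D) ^ 2 = 1 / 4 := by field_simp; norm_num
    rw [h4] at h2
    have h5 : 0 ≤ P.real (firstPassage X a t m) := measureReal_nonneg
    nlinarith
  -- After a first passage above `t`, the gap takes back at most `n₀ L` and the remaining sum at
  -- most `2 D`, which leaves more than `x` at the end.
  have hsub : P.real (⋃ m ∈ Finset.Icc a b, firstPassage X a t m ∩ G m)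
      ≤ P.real {ω | x < ‖segSum X a b ω‖} := by
    refine ENNReal.toReal_mono (measure_ne_top _ _) (measure_mono_ae ?_)
    filter_upwards [hL] with ω hω h
    obtain ⟨m, hm, h1, h2⟩ : ∃ m ∈ Finset.Icc a b, ω ∈ firstPassage X a t m ∧ ω ∈ G m := by
      have h' : ω ∈ ⋃ m ∈ Finset.Icc a b, firstPassage X a t m ∩ G m := h
      simpa only [Set.mem_iUnion, exists_prop, Set.mem_inter_iff] using h'
    have hm' := Finset.mem_Icc.1 hm
    have h3 := norm_segSum_sub_le hω hL0 hn₀ (show a ≤ m + 1 by omega) hm'.2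
    have h4 : t < ‖segSum X a m ω‖ := h1.1
    have h5 : ‖segSum X (m + n₀) b ω‖ ≤ 2 * D := h2
    have h6 := norm_sub_norm_le (segSum X a m ω)
      (-(segSum X a b ω - segSum X a m ω - segSum X (m + n₀) b ω))
    have h7 : segSum X a m ω - -(segSum X a b ω - segSum X a m ω - segSum X (m + n₀) b ω)
      = segSum X a b ω - segSum X (m + n₀) b ω := by abel
    rw [h7, norm_neg] at h6
    have h8 := norm_sub_le (segSum X a b ω) (segSum X (m + n₀) b ω)
    change x < ‖segSum X a b ω‖
    linarith
  rw [measureReal_biUnion_finset ((pairwiseDisjoint_firstPassage a b t).mono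
    fun m => Set.inter_subset_left) fun m _ => (hF' m).inter (hGm' m)] at hsub
  rw [measureReal_exceedSet hmeas ha]
  refine (Finset.sum_le_sum hquarter).trans ?_
  rw [← Finset.mul_sum]
  gcongr

/-- The scale of the geometric tails of the maximum of a segment. -/
noncomputable def tailScale (n₀ : ℕ) (L D : ℝ) : ℝ := 10 * D + (2 * n₀ + 1) * L

/-- Restart at the first passage above `t`: the overshoot is at most `L` and the gap moves the path
by at most `n₀ L`, so reaching the higher level forces a large excursion after the gap. Given the
past, this has probability at most `1/2 + 1/16 < 3/4`. -/
theorem measureReal_exceedSet_add_le (hmeas : ∀ k, 1 ≤ k → Measurable (X k)) {L D t : ℝ} {n₀ : ℕ}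
    (hL0 : 0 ≤ L) (hL : ∀ᵐ ω ∂P, ∀ k, 1 ≤ k → ‖X k ω‖ ≤ L) (hn₀ : 1 ≤ n₀)
    (hφ : phiCoeff P X n₀ < 1 / 2) (hD : 0 < D) {a b : ℕ} (ha : 1 ≤ a)
    (hseg : SegBound P X D a b) (ht : 0 ≤ t) :
    P.real (exceedSet X a b (t + tailScale n₀ L D)) ≤ 3 / 4 * P.real (exceedSet X a b t) := by
  -- The level `8 D` gives `1/64` in Chebyshev, hence `1/16` after the factor `4` of the Ottaviani
  -- inequality. Adding `L + n₀ L` to `Λ` gives exactly `tailScale`.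
  set Λ : ℝ := 8 * D + 2 * D + n₀ * L with hΛ
  set G : ℕ → Set Ω := fun m => exceedSet X (m + n₀) b Λ with hG
  have hF := fun m => measurableSet_firstPassage (X := X) (m := m) ha t
  have hthree : ∀ m ∈ Finset.Icc a b, P.real (firstPassage X a t m ∩ G m)
      ≤ 3 / 4 * P.real (firstPassage X a t m) := by
    intro m hm
    have hma := (Finset.mem_Icc.1 hm).1
    have h1 := (abs_le.1 (abs_sub_le_phiCoeff_mul (P := P) (k := n₀) hmeas (ha.trans hma) (hF m)
      (measurableSet_exceedSet_future (b := b) Λ))).2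
    have hseg' : SegBound P X D (m + n₀) b := hseg.mono (by omega) le_rfl
    have h2 := measureReal_exceedSet_le (x := 8 * D) hmeas hL0 hL hn₀ hφ hD (by omega) hseg'
    have h3 := measureReal_lt_norm_segSum_le (P := P) hmeas hL (a := m + n₀) (b := b) (by omega)
      (y := 8 * D) (by positivity) (hseg' _ _ le_rfl le_rfl)
    have h4 : D ^ 2 / (8 * D) ^ 2 = 1 / 64 := by field_simp; norm_num
    rw [h4] at h3
    have h5 : 0 ≤ P.real (firstPassage X a t m) := measureReal_nonneg
    have h6 : P.real (G m) ≤ 1 / 16 := by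
      refine h2.trans ?_
      linarith
    change P.real (firstPassage X a t m ∩ G m) - _ * P.real (G m) ≤ _ at h1
    nlinarith
  have hsub : P.real (exceedSet X a b (t + tailScale n₀ L D))
      ≤ P.real (⋃ m ∈ Finset.Icc a b, firstPassage X a t m ∩ G m) := by
    refine ENNReal.toReal_mono (measure_ne_top _ _) (measure_mono_ae ?_)
    filter_upwards [hL] with ω hω h
    obtain ⟨r, hr, hrt⟩ : ω ∈ exceedSet X a b (t + tailScale n₀ L D) := h
    have hr' := Finset.mem_Icc.1 hr
    have hW : 0 ≤ tailScale n₀ L D := by unfold tailScale; positivity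
    have hex : ω ∈ exceedSet X a b t := ⟨r, hr, by linarith⟩
    rw [exceedSet_eq_biUnion] at hex
    simp only [Set.mem_iUnion, exists_prop] at hex
    obtain ⟨m, hm, hfp⟩ := hex
    have hm' := Finset.mem_Icc.1 hm
    have hmr : m ≤ r := by
      by_contra! hlt
      have := hfp.2 r (Finset.mem_Ico.2 ⟨hr'.1, hlt⟩)
      linarith
    have hmt : ‖segSum X a m ω‖ ≤ t + L := by
      rcases eq_or_lt_of_le hm'.1 with rfl | hlt
      · have : segSum X a a ω = X a ω := by simp [segSum]
        rw [this]
        linarith [hω a ha]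
      · obtain ⟨m, rfl⟩ : ∃ n, m = n + 1 := ⟨m - 1, by omega⟩
        rw [segSum_succ (by omega)]
        refine (norm_add_le _ _).trans (add_le_add (hfp.2 m ?_) (hω _ (by omega)))
        exact Finset.mem_Ico.2 ⟨by omega, by omega⟩
    have h3 := norm_segSum_sub_le hω hL0 hn₀ (show a ≤ m + 1 by omega) hmr
    have h6 : ‖segSum X a r ω‖ ≤ ‖segSum X a r ω - segSum X a m ω - segSum X (m + n₀) r ω‖
        + ‖segSum X a m ω‖ + ‖segSum X (m + n₀) r ω‖ := by
      refine le_trans (le_of_eq ?_) norm_add₃_le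
      congr 1; abel
    have h7 : Λ < ‖segSum X (m + n₀) r ω‖ := by
      unfold tailScale at hrt
      rw [hΛ]
      nlinarith
    have h8 : m + n₀ ≤ r := by
      by_contra! hlt
      rw [segSum_of_lt hlt] at h7
      have : 0 ≤ Λ := by positivity
      simp at h7
      linarith
    have : ω ∈ ⋃ m ∈ Finset.Icc a b, firstPassage X a t m ∩ G m := by
      simp only [Set.mem_iUnion, exists_prop]
      exact ⟨m, hm, hfp, r, Finset.mem_Icc.2 ⟨h8, hr'.2⟩, h7⟩
    exact this
  refine hsub.trans ((measureReal_biUnion_finset_le _ _).trans ?_)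
  rw [measureReal_exceedSet hmeas ha, Finset.mul_sum]
  exact Finset.sum_le_sum hthree

/-- Geometric tails for the maximum of the partial sums of a segment. -/
theorem measureReal_exceedSet_nat_mul_le (hmeas : ∀ k, 1 ≤ k → Measurable (X k)) {L D : ℝ}
    {n₀ : ℕ} (hL0 : 0 ≤ L) (hL : ∀ᵐ ω ∂P, ∀ k, 1 ≤ k → ‖X k ω‖ ≤ L) (hn₀ : 1 ≤ n₀)
    (hφ : phiCoeff P X n₀ < 1 / 2) (hD : 0 < D) {a b : ℕ} (ha : 1 ≤ a)
    (hseg : SegBound P X D a b) (k : ℕ) :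
    P.real (exceedSet X a b (k * tailScale n₀ L D)) ≤ (3 / 4) ^ k := by
  have hW : 0 ≤ tailScale n₀ L D := by unfold tailScale; positivity
  induction k with
  | zero => simp
  | succ k ih =>
    have := measureReal_exceedSet_add_le hmeas hL0 hL hn₀ hφ hD ha hseg
      (t := k * tailScale n₀ L D) (by positivity)
    push_cast
    rw [add_mul, one_mul, pow_succ]
    linarith

end Mixing

/-! ### Covariance matrices and their quadratic forms -/

section Quad

variable {Ω : Type*} [MeasurableSpace Ω] {P : Measure Ω} {d : ℕ}
  {Y : Ω → EuclideanSpace ℝ (Fin d)}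

lemma memLp_inner_left (hY : MemLp Y 2 P) (u : EuclideanSpace ℝ (Fin d)) :
    MemLp (fun ω => inner ℝ (Y ω) u) 2 P := hY.inner_const u

lemma lpNorm_inner_le (hY : MemLp Y 2 P) {u : EuclideanSpace ℝ (Fin d)} (hu : ‖u‖ = 1) :
    lpNorm (fun ω => inner ℝ (Y ω) u) 2 P ≤ lpNorm Y 2 P := by
  rw [← lpNorm_norm hY.1]
  refine lpNorm_mono_real hY.norm fun ω => ?_
  have := abs_real_inner_le_norm (Y ω) u
  rwa [hu, mul_one] at this

lemma memLp_coord (hY : MemLp Y 2 P) (i : Fin d) : MemLp (fun ω => Y ω i) 2 P := by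
  simpa [EuclideanSpace.inner_single_right] using
    memLp_inner_left hY (EuclideanSpace.single i (1 : ℝ))

variable [IsProbabilityMeasure P]

lemma variance_inner_eq_quadForm (hY : MemLp Y 2 P) (u : EuclideanSpace ℝ (Fin d)) :
    variance (fun ω => inner ℝ (Y ω) u) P = quadForm (covMatrix P Y) u := by
  have h1 : (fun ω => inner ℝ (Y ω) u) = fun ω => ∑ i, u i * Y ω i := by
    ext ω; simp [PiLp.inner_apply]
  rw [h1, variance_fun_sum fun i => (memLp_coord hY i).const_mul (u i)]
  simp only [quadForm, PiLp.inner_apply, Matrix.toLpLin_apply, Matrix.mulVec, dotProduct,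
    covMatrix, Matrix.of_apply, covariance_const_mul_left, covariance_const_mul_right,
    RCLike.inner_apply, conj_trivial, Finset.mul_sum]
  refine Finset.sum_congr rfl fun i _ => Finset.sum_congr rfl fun j _ => ?_
  ring

lemma variance_inner_le (hY : MemLp Y 2 P) {u : EuclideanSpace ℝ (Fin d)} (hu : ‖u‖ = 1) :
    variance (fun ω => inner ℝ (Y ω) u) P ≤ lpNorm Y 2 P ^ 2 := by
  rw [sq_lpNorm_two_eq hY.1]
  refine (variance_le_expectation_sq (memLp_inner_left hY u).1).trans ?_
  refine integral_mono_of_nonneg (ae_of_all _ fun ω => sq_nonneg _)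
    (hY.integrable_norm_pow two_ne_zero) (ae_of_all _ fun ω => ?_)
  have := abs_real_inner_le_norm (Y ω) u
  rw [hu, mul_one] at this
  exact sq_le_sq.2 (by simpa using this)

lemma quadForm_le_maxQuad (hY : MemLp Y 2 P) {u : EuclideanSpace ℝ (Fin d)} (hu : ‖u‖ = 1) :
    quadForm (covMatrix P Y) u ≤ maxQuad (covMatrix P Y) := by
  refine le_ciSup (f := fun u : Metric.sphere (0 : EuclideanSpace ℝ (Fin d)) 1 =>
    quadForm (covMatrix P Y) u) ⟨lpNorm Y 2 P ^ 2, ?_⟩ ⟨u, by simpa using hu⟩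
  rintro _ ⟨v, rfl⟩
  beta_reduce
  rw [← variance_inner_eq_quadForm hY]
  exact variance_inner_le hY (by simp)

lemma minQuad_le_quadForm (hY : MemLp Y 2 P) {u : EuclideanSpace ℝ (Fin d)} (hu : ‖u‖ = 1) :
    minQuad (covMatrix P Y) ≤ quadForm (covMatrix P Y) u := by
  refine ciInf_le (f := fun u : Metric.sphere (0 : EuclideanSpace ℝ (Fin d)) 1 =>
    quadForm (covMatrix P Y) u) ⟨0, ?_⟩ ⟨u, by simpa using hu⟩
  rintro _ ⟨v, rfl⟩
  beta_reduce
  rw [← variance_inner_eq_quadForm hY]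
  exact variance_nonneg _ _

lemma integral_inner_eq_zero (hY : MemLp Y 2 P) (h0 : ∫ ω, Y ω ∂P = 0)
    (u : EuclideanSpace ℝ (Fin d)) : ∫ ω, inner ℝ (Y ω) u ∂P = 0 := by
  simp_rw [fun ω => real_inner_comm u (Y ω)]
  rw [integral_inner (hY.integrable one_le_two), h0, inner_zero_right]

lemma sq_lpNorm_inner (hY : MemLp Y 2 P) (h0 : ∫ ω, Y ω ∂P = 0)
    (u : EuclideanSpace ℝ (Fin d)) :
    lpNorm (fun ω => inner ℝ (Y ω) u) 2 P ^ 2 = variance (fun ω => inner ℝ (Y ω) u) P := by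
  have hm := memLp_inner_left hY u
  rw [sq_lpNorm_two_eq hm.1, variance_of_integral_eq_zero hm.1.aemeasurable
    (integral_inner_eq_zero hY h0 u)]
  simp

/-- For a centred vector the left side is the trace of the covariance matrix, a sum of `d` values of
the quadratic form at unit vectors. -/
lemma sq_lpNorm_le_mul_maxQuad (hY : MemLp Y 2 P) (h0 : ∫ ω, Y ω ∂P = 0) :
    lpNorm Y 2 P ^ 2 ≤ d * maxQuad (covMatrix P Y) := by
  have h1 : lpNorm Y 2 P ^ 2
      = ∑ i, variance (fun ω => inner ℝ (Y ω) (EuclideanSpace.single i (1 : ℝ))) P := by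
    rw [sq_lpNorm_two_eq hY.1]
    simp_rw [EuclideanSpace.norm_sq_eq]
    rw [integral_finsetSum _ fun i _ => by simpa using (memLp_coord hY i).integrable_sq]
    refine Finset.sum_congr rfl fun i _ => ?_
    rw [variance_of_integral_eq_zero (memLp_inner_left hY _).1.aemeasurable
      (integral_inner_eq_zero hY h0 _)]
    simp [EuclideanSpace.inner_single_right]
  rw [h1]
  refine (Finset.sum_le_card_nsmul _ _ (maxQuad (covMatrix P Y)) fun i _ => ?_).trans ?_
  · rw [variance_inner_eq_quadForm hY]
    exact quadForm_le_maxQuad hY (by simp)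
  · simp

end Quad

/-! ### Covariance decay for segment sums and variance of a sum of blocks -/

section Segments

variable {Ω : Type*} [MeasurableSpace Ω] {P : Measure Ω} {d : ℕ}
  {X : ℕ → Ω → EuclideanSpace ℝ (Fin d)}

lemma partialSum_eq_segSum (hmean : ∀ k, 1 ≤ k → ∫ ω, X k ω ∂P = 0) (n : ℕ) :
    partialSum P X n = segSum X 1 n := by
  ext1 ω
  refine Finset.sum_congr rfl fun k hk => ?_
  rw [hmean k (Finset.mem_Icc.1 hk).1, sub_zero]

variable [IsProbabilityMeasure P]

lemma integral_segSum (hmeas : ∀ k, 1 ≤ k → Measurable (X k)) {L : ℝ}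
    (hL : ∀ᵐ ω ∂P, ∀ k, 1 ≤ k → ‖X k ω‖ ≤ L) (hmean : ∀ k, 1 ≤ k → ∫ ω, X k ω ∂P = 0)
    {a b : ℕ} (ha : 1 ≤ a) : ∫ ω, segSum X a b ω ∂P = 0 := by
  unfold segSum
  rw [integral_finsetSum]
  · exact Finset.sum_eq_zero fun k hk => hmean k (ha.trans (Finset.mem_Icc.1 hk).1)
  · intro k hk
    have hk1 := ha.trans (Finset.mem_Icc.1 hk).1
    exact Integrable.of_bound (hmeas k hk1).aestronglyMeasurable L (hL.mono fun ω h => h k hk1)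

/-- Decay of the covariance between distant segments. -/
theorem abs_covariance_segSum_le (hmeas : ∀ k, 1 ≤ k → Measurable (X k)) {L D η : ℝ} {n₀ : ℕ}
    (hL0 : 0 ≤ L) (hL : ∀ᵐ ω ∂P, ∀ k, 1 ≤ k → ‖X k ω‖ ≤ L) (hn₀ : 1 ≤ n₀)
    (hφ : phiCoeff P X n₀ < 1 / 2) (hD : 0 < D) {a b c e k : ℕ} (ha : 1 ≤ a) (hb : 1 ≤ b)
    (hbc : b + k ≤ c) (hη : 0 < η) (hα : alphaCoeff P X k ≤ η ^ 3)
    (hab : SegBound P X D a b) (hce : SegBound P X D c e)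
    {u : EuclideanSpace ℝ (Fin d)} (hu : ‖u‖ = 1) :
    |covariance (fun ω => inner ℝ (segSum X a b ω) u) (fun ω => inner ℝ (segSum X c e ω) u) P|
      ≤ (5 + geomMoment) * tailScale n₀ L D ^ 2 * η := by
  have hc : 1 ≤ c := by omega
  have hDW : D ≤ tailScale n₀ L D := by
    unfold tailScale
    have : 0 ≤ (2 * (n₀ : ℝ) + 1) * L := by positivity
    linarith
  have hW : 0 < tailScale n₀ L D := hD.trans_le hDW
  have hle : ∀ (p q : ℕ) (ω : Ω), |inner ℝ (segSum X p q ω) u| ≤ ‖segSum X p q ω‖ := by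
    intro p q ω
    have := abs_real_inner_le_norm (segSum X p q ω) u
    rwa [hu, mul_one] at this
  have hbound : ∀ p q : ℕ, 1 ≤ p → ∀ᵐ ω ∂P, |inner ℝ (segSum X p q ω) u|
      ≤ ((q + 1 - p : ℕ) : ℝ) * L := by
    intro p q hp
    filter_upwards [hL] with ω hω using (hle p q ω).trans (norm_segSum_le hω hp)
  have hsq : ∀ p q : ℕ, 1 ≤ p → SegBound P X D p q →
      ∫ ω, inner ℝ (segSum X p q ω) u ^ 2 ∂P ≤ tailScale n₀ L D ^ 2 := by
    intro p q hp hs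
    have hm := memLp_segSum (P := P) hmeas hL (b := q) hp 2
    have h1 := sq_lpNorm_two_eq (memLp_inner_left hm u).1
    simp only [Real.norm_eq_abs, sq_abs] at h1
    rw [← h1]
    exact pow_le_pow_left₀ lpNorm_nonneg
      ((lpNorm_inner_le hm hu).trans ((hs p q le_rfl le_rfl).trans hDW)) 2
  have htail : ∀ p q : ℕ, 1 ≤ p → SegBound P X D p q → ∀ k : ℕ,
      P.real {ω | k * tailScale n₀ L D < |inner ℝ (segSum X p q ω) u|} ≤ (3 / 4) ^ k := by
    intro p q hp hs k
    -- The full sum is the last of the partial sums, so the tail of the maximum dominates; an empty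
    -- segment cannot exceed a nonnegative level.
    refine le_trans (measureReal_mono ?_)
      (measureReal_exceedSet_nat_mul_le hmeas hL0 hL hn₀ hφ hD hp hs k)
    intro ω hω
    have h1 : k * tailScale n₀ L D < ‖segSum X p q ω‖ := lt_of_lt_of_le hω (hle p q ω)
    refine ⟨q, Finset.mem_Icc.2 ⟨?_, le_rfl⟩, h1⟩
    by_contra! hlt
    rw [segSum_of_lt hlt] at h1
    have : 0 ≤ k * tailScale n₀ L D := by positivity
    simp at h1
    linarith
  have hinner : Measurable fun x : EuclideanSpace ℝ (Fin d) => (inner ℝ x u : ℝ) := by fun_prop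
  refine abs_covariance_le_of_tail (m₁ := pastSigma X b) (m₂ := futureSigma X (b + k))
    (pastSigma_le hmeas b) (futureSigma_le hmeas (by omega)) hη
    (fun A B hA hB => (abs_sub_le_alphaCoeff hb hA hB).trans hα)
    (hinner.comp (measurable_segSum_past ha le_rfl)) (hinner.comp (measurable_segSum_future hbc))
    (B := max (((b + 1 - a : ℕ) : ℝ) * L) (((e + 1 - c : ℕ) : ℝ) * L)) hW ?_ ?_
    (hsq a b ha hab) (hsq c e hc hce) (htail a b ha hab) (htail c e hc hce)
  · exact (hbound a b ha).mono fun ω h => h.trans (le_max_left _ _)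
  · exact (hbound c e hc).mono fun ω h => h.trans (le_max_right _ _)

/-- The variance of a sum with summably decaying covariances is comparable to the number
of summands. -/
theorem abs_variance_sum_sub_le {Z : ℕ → Ω → ℝ} (hZ : ∀ j, MemLp (Z j) 2 P) {β : ℕ → ℝ} {s : ℝ}
    (hβs : ∀ n, ∑ q ∈ Finset.range n, β q ≤ s)
    (hcov : ∀ i q, |covariance (Z i) (Z (i + q + 1)) P| ≤ β q) (k : ℕ) :
    |variance (fun ω => ∑ j ∈ Finset.range k, Z j ω) P - ∑ j ∈ Finset.range k, variance (Z j) P|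
      ≤ 2 * s * k := by
  induction k with
  | zero => simp [variance_zero, ← Pi.zero_def]
  | succ k ih =>
    have hm : MemLp (fun ω => ∑ j ∈ Finset.range k, Z j ω) 2 P :=
      memLp_finsetSum _ fun j _ => hZ j
    simp_rw [Finset.sum_range_succ]
    rw [variance_fun_add hm (hZ k), covariance_fun_sum_left' (fun j _ => hZ j) (hZ k)]
    -- Reindexing by the lag `k - 1 - j` bounds the covariances with the new summand by a partial
    -- sum of `β`.
    have hc : |∑ j ∈ Finset.range k, covariance (Z j) (Z k) P| ≤ s := by
      refine (Finset.abs_sum_le_sum_abs _ _).trans (le_trans ?_ (hβs k))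
      rw [← Finset.sum_range_reflect β]
      refine Finset.sum_le_sum fun j hj => ?_
      have hjk := Finset.mem_range.1 hj
      have := hcov j (k - 1 - j)
      rwa [show j + (k - 1 - j) + 1 = k by omega] at this
    rw [abs_le] at ih hc ⊢
    push_cast
    constructor <;> linarith [ih.1, ih.2, hc.1, hc.2]

end Segments

/-! ### Block partitions -/

/-- Greedy choice of consecutive blocks at the first crossing of a threshold. -/
lemma exists_greedy_blocks {N : ℕ → ℕ → ℝ} {A : ℝ} (h : ∀ a, 1 ≤ a → ∃ m, a ≤ m ∧ A ≤ N a m) :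
    ∃ b : ℕ → ℕ, b 0 = 0 ∧ StrictMono b ∧ ∀ j, A ≤ N (b j + 1) (b (j + 1)) ∧
      ∀ m, b j + 1 ≤ m → m < b (j + 1) → N (b j + 1) m < A := by
  classical
  have h' : ∀ p : ℕ, ∃ m, p + 1 ≤ m ∧ A ≤ N (p + 1) m := fun p => h _ (by omega)
  -- Starting from `b 0 = 0`, blocks begin at `b j + 1`, so the first one begins at `1`.
  set b : ℕ → ℕ := fun j => Nat.rec 0 (fun _ p => Nat.find (h' p)) j with hb
  have hstep : ∀ j, b (j + 1) = Nat.find (h' (b j)) := fun j => rfl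
  refine ⟨b, rfl, strictMono_nat_of_lt_succ fun j => ?_, fun j => ⟨?_, fun m hm hlt => ?_⟩⟩
  · rw [hstep]; exact (Nat.find_spec (h' (b j))).1
  · rw [hstep]; exact (Nat.find_spec (h' (b j))).2
  · rw [hstep] at hlt
    by_contra! hle
    exact Nat.find_min (h' (b j)) hlt ⟨hm, hle⟩

section Partition

variable {b : ℕ → ℕ}

lemma blockCount_eq (hb : StrictMono b) {k n : ℕ} (h₀ : k = 0 ∨ b k ≤ n) (h₁ : n < b (k + 1)) :
    blockCount b n = k := by
  have hle : ∀ i ∈ {k : ℕ | 1 ≤ k ∧ b k ≤ n}, i ≤ k := by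
    rintro i ⟨-, hi⟩
    by_contra! hlt
    have := hb.monotone (show k + 1 ≤ i by omega)
    omega
  rcases Nat.eq_zero_or_pos k with rfl | hk
  · have : {k : ℕ | 1 ≤ k ∧ b k ≤ n} = ∅ := by
      ext i
      simp only [Set.mem_empty_iff_false, iff_false]
      intro hi
      have := hle i hi
      have := hi.1
      omega
    -- In `ℕ` the supremum of the empty set is `0`, which is the convention for `n < b 1`.
    rw [blockCount, this, csSup_empty]; rfl
  · refine le_antisymm (csSup_le ⟨k, hk, ?_⟩ hle) (le_csSup ⟨k, hle⟩ ⟨hk, ?_⟩) <;>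
    · rcases h₀ with h | h
      · omega
      · exact h

lemma blockCount_spec (hb : StrictMono b) (h0 : b 0 = 0) (n : ℕ) :
    b (blockCount b n) ≤ n ∧ n < b (blockCount b n + 1) := by
  obtain ⟨k, hk1, hk2⟩ : ∃ k, b k ≤ n ∧ n < b (k + 1) := by
    classical
    have hex : ∃ k, n < b k := ⟨n + 1, (Nat.lt_succ_self n).trans_le (hb.id_le _)⟩
    have hpos : Nat.find hex ≠ 0 := fun h => by
      have := Nat.find_spec hex
      rw [h, h0] at this
      omega
    refine ⟨Nat.find hex - 1, ?_, ?_⟩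
    · exact not_lt.1 (Nat.find_min hex (by omega))
    · rw [Nat.sub_add_cancel (by omega)]; exact Nat.find_spec hex
  rw [blockCount_eq hb (Or.inr hk1) hk2]
  exact ⟨hk1, hk2⟩

lemma tendsto_blockCount (hb : StrictMono b) (h0 : b 0 = 0) :
    Tendsto (fun n => blockCount b n) atTop atTop := by
  refine tendsto_atTop.2 fun k => ?_
  filter_upwards [eventually_ge_atTop (b k)] with n hn
  have := (blockCount_spec hb h0 n).2
  have := hb.lt_iff_lt.1 (hn.trans_lt this)
  omega

lemma isBlockPartition_of_strictMono (hb : StrictMono b) (h0 : b 0 = 0) :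
    IsBlockPartition (fun j => b (j - 1) + 1) b := by
  have hdisj : ∀ i j, 1 ≤ i → i < j →
      Disjoint (Set.Icc (b (i - 1) + 1) (b i)) (Set.Icc (b (j - 1) + 1) (b j)) := by
    intro i j _ hij
    refine Set.disjoint_left.2 fun x hx hy => ?_
    have := hb.monotone (show i ≤ j - 1 by omega)
    have := hx.2
    have := hy.1
    omega
  refine ⟨fun j hj => hb (by omega), fun j _ => Nat.lt_succ_self _, fun i j hi hj hij => ?_, ?_⟩
  · rcases lt_or_gt_of_ne hij with h | h
    · exact hdisj i j hi h
    · exact (hdisj j i hj h).symm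
  · ext n
    simp only [Set.mem_iUnion, Set.mem_Ici, Set.mem_Icc, exists_prop]
    constructor
    · rintro ⟨j, -, h, -⟩
      omega
    · intro hn
      -- The shift to `n - 1` counts only blocks ending strictly before `n`; the block containing
      -- `n` is the next one.
      have h := blockCount_spec hb h0 (n - 1)
      exact ⟨blockCount b (n - 1) + 1, by omega, by simp only [Nat.add_sub_cancel]; omega, by omega⟩

lemma sum_segSum_blocks {Ω : Type*} {d : ℕ} (X : ℕ → Ω → EuclideanSpace ℝ (Fin d))
    (hb : StrictMono b) (h0 : b 0 = 0) (k : ℕ) (ω : Ω) :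
    ∑ j ∈ Finset.range k, segSum X (b j + 1) (b (j + 1)) ω = segSum X 1 (b k) ω := by
  induction k with
  | zero => simp [h0, segSum]
  | succ k ih =>
    rw [Finset.sum_range_succ, ih]
    exact segSum_add_segSum (by omega) (hb.monotone (Nat.le_succ k)) ω

lemma sum_Icc_segSum_blocks {Ω : Type*} {d : ℕ} (X : ℕ → Ω → EuclideanSpace ℝ (Fin d))
    (hb : StrictMono b) (h0 : b 0 = 0) (k : ℕ) (ω : Ω) :
    ∑ j ∈ Finset.Icc 1 k, segSum X (b (j - 1) + 1) (b j) ω = segSum X 1 (b k) ω := by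
  rw [← sum_segSum_blocks X hb h0, ← Finset.Ico_add_one_right_eq_Icc, Finset.sum_Ico_eq_sum_range]
  refine Finset.sum_congr (by simp) fun j _ => ?_
  simp [add_comm 1 j]

end Partition

/-! ### Estimates for the blocks -/

section Blocks

variable {Ω : Type*} [MeasurableSpace Ω] {P : Measure Ω} [IsProbabilityMeasure P] {d : ℕ}
  {X : ℕ → Ω → EuclideanSpace ℝ (Fin d)} {L : ℝ}

lemma lpNorm_segSum_le (hmeas : ∀ k, 1 ≤ k → Measurable (X k)) (hL0 : 0 ≤ L)
    (hL : ∀ᵐ ω ∂P, ∀ k, 1 ≤ k → ‖X k ω‖ ≤ L) {a b : ℕ} (ha : 1 ≤ a) :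
    lpNorm (segSum X a b) 2 P ≤ ((b + 1 - a : ℕ) : ℝ) * L := by
  have hm := memLp_segSum (P := P) hmeas hL (b := b) ha 2
  refine (sq_le_sq₀ lpNorm_nonneg (by positivity)).1 ?_
  rw [sq_lpNorm_two_eq hm.1]
  refine (integral_mono_ae (hm.integrable_norm_pow two_ne_zero)
    (integrable_const ((((b + 1 - a : ℕ) : ℝ) * L) ^ 2)) ?_).trans (by simp)
  filter_upwards [hL] with ω hω
  exact pow_le_pow_left₀ (norm_nonneg _) (norm_segSum_le hω ha) 2

lemma lpNorm_segSum_le_add (hmeas : ∀ k, 1 ≤ k → Measurable (X k))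
    (hL : ∀ᵐ ω ∂P, ∀ k, 1 ≤ k → ‖X k ω‖ ≤ L) {a m r : ℕ} (ha : 1 ≤ a) (h₁ : a ≤ m + 1)
    (h₂ : m ≤ r) :
    lpNorm (segSum X a r) 2 P ≤ lpNorm (segSum X a m) 2 P + lpNorm (segSum X (m + 1) r) 2 P := by
  have : segSum X a r = segSum X a m + segSum X (m + 1) r :=
    funext fun ω => (segSum_add_segSum h₁ h₂ ω).symm
  rw [this]
  exact lpNorm_add_le (memLp_segSum hmeas hL ha 2) one_le_two

lemma lpNorm_segSum_right_le_add (hmeas : ∀ k, 1 ≤ k → Measurable (X k))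
    (hL : ∀ᵐ ω ∂P, ∀ k, 1 ≤ k → ‖X k ω‖ ≤ L) {a m r : ℕ} (ha : 1 ≤ a) (h₁ : a ≤ m + 1)
    (h₂ : m ≤ r) :
    lpNorm (segSum X (m + 1) r) 2 P ≤ lpNorm (segSum X a r) 2 P + lpNorm (segSum X a m) 2 P := by
  have : segSum X (m + 1) r = segSum X a r - segSum X a m :=
    funext fun ω => by simp [← segSum_add_segSum h₁ h₂ ω]
  rw [this]
  exact lpNorm_sub_le (memLp_segSum hmeas hL ha 2) one_le_two

/-- Before and at the first crossing of `A` the norms are at most `A + L`. -/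
lemma lpNorm_segSum_le_of_first_crossing (hmeas : ∀ k, 1 ≤ k → Measurable (X k)) (hL0 : 0 ≤ L)
    (hL : ∀ᵐ ω ∂P, ∀ k, 1 ≤ k → ‖X k ω‖ ≤ L) {A : ℝ} (hA : 0 ≤ A) {p q : ℕ} (hp : 1 ≤ p)
    (hpq : p ≤ q) (hlt : ∀ m, p ≤ m → m < q → lpNorm (segSum X p m) 2 P < A) {m : ℕ}
    (hm : m ≤ q) : lpNorm (segSum X p m) 2 P ≤ A + L := by
  have hlt' : ∀ m, m < q → lpNorm (segSum X p m) 2 P ≤ A := by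
    intro m hmq
    rcases le_or_gt p m with h | h
    · exact (hlt m h hmq).le
    · rw [segSum_of_lt h, lpNorm_zero]; exact hA
  rcases lt_or_eq_of_le hm with h | rfl
  · linarith [hlt' m h]
  · obtain ⟨m, rfl⟩ : ∃ n, m = n + 1 := ⟨m - 1, by omega⟩
    have h1 := lpNorm_segSum_le_add (P := P) hmeas hL (r := m + 1) hp hpq (by omega)
    have h2 := lpNorm_segSum_le (P := P) hmeas hL0 hL (a := m + 1) (b := m + 1) (by omega)
    simp only [Nat.add_sub_cancel_left, Nat.cast_one, one_mul] at h2
    linarith [hlt' m (by omega)]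

/-- An inner segment is the difference of two prefixes, whence the factor `2`. -/
lemma segBound_of_lpNorm_le (hmeas : ∀ k, 1 ≤ k → Measurable (X k))
    (hL : ∀ᵐ ω ∂P, ∀ k, 1 ≤ k → ‖X k ω‖ ≤ L) {c : ℝ} {p q : ℕ} (hp : 1 ≤ p)
    (h : ∀ m, m ≤ q → lpNorm (segSum X p m) 2 P ≤ c) : SegBound P X (2 * c) p q := by
  intro i j hi hj
  have hc : 0 ≤ c := lpNorm_nonneg.trans (h 0 (Nat.zero_le q))
  rcases lt_or_ge j i with hji | hij
  · rw [segSum_of_lt hji, lpNorm_zero]; positivity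
  · obtain ⟨m, rfl⟩ : ∃ n, i = n + 1 := ⟨i - 1, by omega⟩
    have h1 := lpNorm_segSum_right_le_add (P := P) hmeas hL (a := p) (m := m) (r := j) hp hi
      (by omega)
    linarith [h j hj, h m (by omega)]

/-- Lower bound for the variance of a long segment in any direction. -/
lemma le_variance_inner_segSum (hmeas : ∀ k, 1 ≤ k → Measurable (X k))
    (hL : ∀ᵐ ω ∂P, ∀ k, 1 ≤ k → ‖X k ω‖ ≤ L) (hmean : ∀ k, 1 ≤ k → ∫ ω, X k ω ∂P = 0)
    (hd : 1 ≤ d) {A C₂ : ℝ} (hA : 0 ≤ A) (hC₂ : 0 < C₂) {a b : ℕ} (ha : 1 ≤ a)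
    (hcomp : maxQuad (covMatrix P (segSum X a b)) ≤ C₂ * minQuad (covMatrix P (segSum X a b)))
    (hle : A ≤ lpNorm (segSum X a b) 2 P) {u : EuclideanSpace ℝ (Fin d)} (hu : ‖u‖ = 1) :
    A ^ 2 / (d * C₂) ≤ variance (fun ω => inner ℝ (segSum X a b ω) u) P := by
  have hm := memLp_segSum (P := P) hmeas hL (b := b) ha 2
  have hd' : (0 : ℝ) < d := by exact_mod_cast hd
  rw [variance_inner_eq_quadForm hm, div_le_iff₀ (by positivity)]
  calc A ^ 2 ≤ lpNorm (segSum X a b) 2 P ^ 2 := pow_le_pow_left₀ hA hle 2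
    _ ≤ d * maxQuad (covMatrix P (segSum X a b)) :=
      sq_lpNorm_le_mul_maxQuad hm (integral_segSum hmeas hL hmean ha)
    _ ≤ d * (C₂ * quadForm (covMatrix P (segSum X a b)) u) := by
      gcongr
      refine hcomp.trans ?_
      gcongr
      exact minQuad_le_quadForm hm hu
    _ = _ := by ring

/-- Covariances between the blocks decay geometrically, and neighbouring blocks are nearly
uncorrelated on the scale of their variances. -/
theorem abs_covariance_blocks_le (hmeas : ∀ k, 1 ≤ k → Measurable (X k)) (hL0 : 0 < L)
    (hL : ∀ᵐ ω ∂P, ∀ k, 1 ≤ k → ‖X k ω‖ ≤ L) {n₀ : ℕ} (hn₀ : 1 ≤ n₀)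
    (hφ : phiCoeff P X n₀ < 1 / 2) {C ρ : ℝ} (hC : 0 < C) (hρ : 0 < ρ)
    (hα : ∀ k, 1 ≤ k → alphaCoeff P X k ≤ (C * ρ ^ k) ^ 3) {ℓ : ℕ} (hℓ : 2 ≤ ℓ)
    {A : ℝ} (hA : A = (ℓ : ℝ) ^ 2 * L) {b : ℕ → ℕ} (hlen : ∀ j, b j + ℓ ^ 2 ≤ b (j + 1))
    (hblock : ∀ j m, m ≤ b (j + 1) → lpNorm (segSum X (b j + 1) m) 2 P ≤ A + L)
    {u : EuclideanSpace ℝ (Fin d)} (hu : ‖u‖ = 1) (i q : ℕ) :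
    |covariance (fun ω => inner ℝ (segSum X (b i + 1) (b (i + 1)) ω) u)
      (fun ω => inner ℝ (segSum X (b (i + q + 1) + 1) (b (i + q + 1 + 1)) ω) u) P|
      ≤ A ^ 2 * ((if q = 0 then 5 / (2 * (ℓ : ℝ)) else 0)
        + (5 + geomMoment) * (41 + 2 * n₀) ^ 2 * C * ρ ^ ℓ * ρ ^ q) := by
  have hℓ' : (2 : ℝ) ≤ ℓ := by exact_mod_cast hℓ
  have hLA : L ≤ A := by rw [hA]; exact le_mul_of_one_le_left hL0.le (by nlinarith)
  have hA0 : 0 < A := hL0.trans_le hLA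
  have hseg : ∀ j, SegBound P X (2 * (A + L)) (b j + 1) (b (j + 1)) := fun j =>
    segBound_of_lpNorm_le hmeas hL (by omega) (hblock j)
  have hκ := geomMoment_nonneg
  -- Since `L ≤ A`, the tail scale is a multiple of `A` whose factor does not involve `ℓ`; this is
  -- what lets `ℓ` be chosen afterwards.
  have hW : tailScale n₀ L (2 * (A + L)) ^ 2 ≤ ((41 + 2 * n₀) * A) ^ 2 := by
    refine pow_le_pow_left₀ (by unfold tailScale; positivity) ?_ 2
    unfold tailScale
    nlinarith [mul_le_mul_of_nonneg_left hLA (show (0 : ℝ) ≤ 2 * n₀ + 1 by positivity)]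
  have hfar : ∀ {s r c e : ℕ}, 1 ≤ s → 1 ≤ r → r + (ℓ + q) ≤ c →
      SegBound P X (2 * (A + L)) s r → SegBound P X (2 * (A + L)) c e →
      |covariance (fun ω => inner ℝ (segSum X s r ω) u) (fun ω => inner ℝ (segSum X c e ω) u) P|
        ≤ A ^ 2 * ((5 + geomMoment) * (41 + 2 * n₀) ^ 2 * C * ρ ^ ℓ * ρ ^ q) := by
    intro s r c e hs hr hc h1 h2
    refine (abs_covariance_segSum_le hmeas hL0.le hL hn₀ hφ (by positivity) hs hr hc
      (by positivity) (hα (ℓ + q) (by omega)) h1 h2 hu).trans ?_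
    calc (5 + geomMoment) * tailScale n₀ L (2 * (A + L)) ^ 2 * (C * ρ ^ (ℓ + q))
        ≤ (5 + geomMoment) * ((41 + 2 * n₀) * A) ^ 2 * (C * ρ ^ (ℓ + q)) := by gcongr
      _ = _ := by ring
  have hℓ2 : ℓ + 2 ≤ ℓ ^ 2 := by nlinarith
  rcases Nat.eq_zero_or_pos q with rfl | hq
  -- Adjacent blocks: the last `ℓ` terms of the left block have norm at most `ℓ L = A / ℓ` and cost
  -- `(1/ℓ)(4 A² + A²)/2`; the rest is separated by a gap of length `ℓ`.
  · simp only [if_true, add_zero] at hfar ⊢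
    have hi := hlen i
    set r := b (i + 1) - ℓ with hr
    have hm₁ := memLp_inner_left
      (memLp_segSum (P := P) hmeas hL (a := b i + 1) (b := r) (by omega) 2) u
    have hm₂ := memLp_inner_left
      (memLp_segSum (P := P) hmeas hL (a := r + 1) (b := b (i + 1)) (by omega) 2) u
    have hm₃ := memLp_segSum (P := P) hmeas hL (a := b (i + 1) + 1) (b := b (i + 1 + 1))
      (by omega) 2
    have hsplit : (fun ω => (inner ℝ (segSum X (b i + 1) (b (i + 1)) ω) u : ℝ))
        = (fun ω => inner ℝ (segSum X (b i + 1) r ω) u)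
          + fun ω => inner ℝ (segSum X (r + 1) (b (i + 1)) ω) u := by
      ext ω
      rw [Pi.add_apply, ← inner_add_left, segSum_add_segSum (by omega) (by omega)]
    rw [hsplit, covariance_add_left hm₁ hm₂ (memLp_inner_left hm₃ u)]
    have h1 := hfar (s := b i + 1) (r := r) (c := b (i + 1) + 1) (e := b (i + 1 + 1)) (by omega)
      (by omega) (by omega) ((hseg i).mono le_rfl (by omega)) (hseg (i + 1))
    have hv₃ : variance (fun ω => inner ℝ (segSum X (b (i + 1) + 1) (b (i + 1 + 1)) ω) u) P
        ≤ 4 * A ^ 2 := by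
      refine (variance_inner_le hm₃ hu).trans ?_
      refine (pow_le_pow_left₀ lpNorm_nonneg (hblock (i + 1) _ le_rfl) 2).trans ?_
      nlinarith
    have hv₂ : variance (fun ω => inner ℝ (segSum X (r + 1) (b (i + 1)) ω) u) P
        ≤ (1 / (ℓ : ℝ)) ^ 2 * A ^ 2 := by
      refine (variance_inner_le (memLp_segSum hmeas hL (by omega) 2) hu).trans ?_
      refine (pow_le_pow_left₀ lpNorm_nonneg
        (lpNorm_segSum_le hmeas hL0.le hL (by omega)) 2).trans (le_of_eq ?_)
      rw [show b (i + 1) + 1 - (r + 1) = ℓ by omega, hA]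
      field_simp
    have h2 := abs_covariance_le_of_variance_le (memLp_inner_left hm₃ u) hm₂
      (show 0 < 1 / (ℓ : ℝ) by positivity) hv₃ hv₂
    rw [covariance_comm] at h2
    refine (abs_add_le _ _).trans ((add_le_add h1 h2).trans (le_of_eq ?_))
    field_simp
    ring
  · rw [if_neg (by omega), zero_add]
    -- The `q` intermediate blocks, each of length at least `ℓ²`, supply the gap `ℓ + q`.
    have hgap : ∀ q, b (i + 1) + q * ℓ ^ 2 ≤ b (i + q + 1) := by
      intro q
      induction q with
      | zero => simp
      | succ q ih =>
        have := hlen (i + q + 1)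
        rw [show i + (q + 1) + 1 = i + q + 1 + 1 by ring]
        linarith
    have h1 := hgap q
    have h2 : ℓ + q ≤ q * ℓ ^ 2 + 1 := by nlinarith
    have h3 := hlen i
    exact hfar (by omega) (by omega) (by omega) (hseg i) (hseg (i + q + 1))

/-- The weighted mean inequality with weight `1` gives the upper bound, and with weight `1/2` the
lower one. It lets an incomplete last block be discarded. -/
lemma variance_add_bounds {f g : Ω → ℝ} (hf : MemLp f 2 P) (hg : MemLp g 2 P) :
    variance f P / 2 - variance g P ≤ variance (fun ω => f ω + g ω) P ∧
      variance (fun ω => f ω + g ω) P ≤ 2 * variance f P + 2 * variance g P := by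
  rw [variance_fun_add hf hg]
  have h1 := (abs_le.1 (abs_covariance_le_of_variance_le hf hg one_pos le_rfl
    (V' := variance g P) (by simp))).2
  have h2 := (abs_le.1 (abs_covariance_le_of_variance_le hf hg (η := 1 / 2) (by norm_num) le_rfl
    (V' := 4 * variance g P) (by linarith))).1
  constructor <;> linarith

/-- Almost surely the oscillation in the `j`-th block is at most logarithmic in `j`. -/
theorem ae_eventually_notMem_exceedSet {W : ℝ} {E : ℕ → ℝ → Set Ω}
    (htail : ∀ j k : ℕ, P.real (E j (k * W)) ≤ (3 / 4) ^ k) :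
    ∀ᵐ ω ∂P, ∀ᶠ j : ℕ in atTop, ω ∉ E j (⌈8 * Real.log ((j : ℝ) + 1)⌉₊ * W) := by
  refine ae_eventually_notMem ?_
  have hsum : Summable fun j : ℕ => 1 / ((j : ℝ) + 1) ^ 2 := by
    have := (summable_nat_add_iff 1).2 (Real.summable_one_div_nat_pow.2 one_lt_two)
    exact_mod_cast this
  refine ne_top_of_le_ne_top hsum.tsum_ofReal_ne_top (ENNReal.tsum_le_tsum fun j => ?_)
  rw [← ofReal_measureReal]
  refine ENNReal.ofReal_le_ofReal ((htail j _).trans ?_)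
  set k := ⌈8 * Real.log ((j : ℝ) + 1)⌉₊
  have hk : 8 * Real.log ((j : ℝ) + 1) ≤ k := Nat.le_ceil _
  have hj : (0 : ℝ) < (j : ℝ) + 1 := by positivity
  -- As `3/4 ≤ exp(-1/4)`, the factor `8` in the level produces the summable bound `(j + 1)⁻²`.
  calc (3 / 4 : ℝ) ^ k ≤ Real.exp (-(1 / 4)) ^ k := by
        refine pow_le_pow_left₀ (by norm_num) ?_ k
        linarith [Real.add_one_le_exp (-(1 / 4 : ℝ))]
    _ = Real.exp (k * -(1 / 4)) := by rw [Real.exp_nat_mul]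
    _ ≤ Real.exp (-(Real.log (((j : ℝ) + 1) ^ 2))) := by
        rw [Real.log_pow]
        refine Real.exp_le_exp.2 ?_
        push_cast
        linarith
    _ = 1 / ((j : ℝ) + 1) ^ 2 := by
        rw [Real.exp_neg, Real.exp_log (by positivity), one_div]

lemma ceil_log_isLittleO_rpow {ε : ℝ} (hε : 0 < ε) :
    (fun k : ℕ => (⌈8 * Real.log ((k : ℝ) + 1)⌉₊ : ℝ)) =o[atTop] fun k : ℕ => ((k : ℝ) + 1) ^ ε := by
  have ht : Tendsto (fun k : ℕ => (k : ℝ) + 1) atTop atTop :=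
    tendsto_atTop_add_const_right _ _ tendsto_natCast_atTop_atTop
  have h1 : (fun k : ℕ => 8 * Real.log ((k : ℝ) + 1)) =o[atTop] fun k : ℕ => ((k : ℝ) + 1) ^ ε :=
    ((isLittleO_log_rpow_atTop hε).comp_tendsto ht).const_mul_left 8
  have h2 : (fun _ : ℕ => (1 : ℝ)) =o[atTop] fun k : ℕ => ((k : ℝ) + 1) ^ ε := by
    rw [isLittleO_const_left]
    exact Or.inr (tendsto_norm_atTop_atTop.comp ((tendsto_rpow_atTop hε).comp ht))
  refine IsBigO.trans_isLittleO (IsBigO.of_bound 1 ?_) (h1.add h2)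
  filter_upwards with k
  have hlog : 0 ≤ Real.log ((k : ℝ) + 1) :=
    Real.log_nonneg (by linarith [show (0 : ℝ) ≤ k by positivity])
  rw [Real.norm_of_nonneg (by positivity), Real.norm_of_nonneg (by positivity), one_mul]
  exact (Nat.ceil_lt_add_one (by positivity)).le

end Blocks

/-! ### Choice of parameters and assembly of the theorem -/

section Main

variable {Ω : Type*} [MeasurableSpace Ω] {P : Measure Ω} [IsProbabilityMeasure P] {d : ℕ}
  {X : ℕ → Ω → EuclideanSpace ℝ (Fin d)} {L : ℝ}

/-- If the smallest variance of the partial sums diverges, so do the norms of the sums started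
at any index. -/
lemma exists_le_lpNorm_segSum (hmeas : ∀ k, 1 ≤ k → Measurable (X k))
    (hL : ∀ᵐ ω ∂P, ∀ k, 1 ≤ k → ‖X k ω‖ ≤ L) (hmean : ∀ k, 1 ≤ k → ∫ ω, X k ω ∂P = 0)
    (hd : 1 ≤ d) (hs : Tendsto (fun n => minVar P X n) atTop atTop) (A : ℝ) {a : ℕ}
    (ha : 1 ≤ a) : ∃ m, a ≤ m ∧ A ≤ lpNorm (segSum X a m) 2 P := by
  -- The sum from `1` to `m` is taken large enough to remain at least `A` after the initial piece
  -- before `a` is removed.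
  obtain ⟨m, hm1, hm2⟩ := ((eventually_ge_atTop a).and
    (hs.eventually_ge_atTop ((A + lpNorm (segSum X 1 (a - 1)) 2 P) ^ 2))).exists
  refine ⟨m, hm1, ?_⟩
  have hmem := memLp_segSum (P := P) hmeas hL (b := m) le_rfl 2
  have h1 : minVar P X m ≤ lpNorm (segSum X 1 m) 2 P ^ 2 := by
    have he : ‖EuclideanSpace.single (⟨0, hd⟩ : Fin d) (1 : ℝ)‖ = 1 := by simp
    rw [minVar, partialSum_eq_segSum hmean]
    refine (minQuad_le_quadForm hmem he).trans ?_
    rw [← variance_inner_eq_quadForm hmem]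
    exact variance_inner_le hmem he
  have h2 := abs_le_of_sq_le_sq (hm2.trans h1) lpNorm_nonneg
  have h3 := lpNorm_segSum_le_add (P := P) hmeas hL (a := 1) (m := a - 1) (r := m) le_rfl
    (by omega) (by omega)
  rw [Nat.sub_add_cancel ha] at h3
  linarith [le_abs_self (A + lpNorm (segSum X 1 (a - 1)) 2 P)]

/-- A geometric rate can be written as the cube of a geometric rate. -/
lemma exists_cube_rate {C δ : ℝ} (hδ0 : 0 < δ) (hδ1 : δ < 1) :
    ∃ C' ρ : ℝ, 0 < C' ∧ 0 < ρ ∧ ρ < 1 ∧ ∀ n : ℕ, C * δ ^ n ≤ (C' * ρ ^ n) ^ 3 := by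
  have hρ3 : (δ ^ (1 / 3 : ℝ)) ^ 3 = δ := by
    rw [← Real.rpow_natCast, ← Real.rpow_mul hδ0.le]
    norm_num
  refine ⟨max C 1, δ ^ (1 / 3 : ℝ), by positivity, by positivity,
    Real.rpow_lt_one hδ0.le hδ1 (by norm_num), fun n => ?_⟩
  have h1 : C ≤ max C 1 ^ 3 :=
    (le_max_left C 1).trans (le_self_pow₀ (le_max_right C 1) (by norm_num))
  calc C * δ ^ n ≤ max C 1 ^ 3 * δ ^ n := by gcongr
    _ = (max C 1 * (δ ^ (1 / 3 : ℝ)) ^ n) ^ 3 := by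
      rw [mul_pow, ← pow_mul, mul_comm n 3, pow_mul, hρ3]

/-- The quantity made small is the sum of the block covariances over all lags, in units of `A²`.
Both terms vanish as `ℓ → ∞` because `K` is fixed beforehand. -/
lemma exists_block_parameter {K ρ η c : ℝ} (hρ0 : 0 < ρ) (hρ1 : ρ < 1) (hη : 0 < η) :
    ∃ ℓ : ℕ, 2 ≤ ℓ ∧ c ≤ ℓ ∧ 5 / (2 * (ℓ : ℝ)) + K * ρ ^ ℓ * (1 - ρ)⁻¹ ≤ η := by
  have h1 : Tendsto (fun ℓ : ℕ => 5 / (2 * (ℓ : ℝ))) atTop (nhds 0) :=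
    tendsto_const_nhds.div_atTop
      (tendsto_natCast_atTop_atTop.const_mul_atTop (by norm_num : (0 : ℝ) < 2))
  have h2 : Tendsto (fun ℓ : ℕ => K * ρ ^ ℓ * (1 - ρ)⁻¹) atTop (nhds 0) := by
    simpa using ((tendsto_pow_atTop_nhds_zero_of_lt_one hρ0.le hρ1).const_mul K).mul_const
      (1 - ρ)⁻¹
  have h3 := h1.add h2
  rw [add_zero] at h3
  obtain ⟨ℓ, h⟩ := ((eventually_ge_atTop 2).and
    ((tendsto_natCast_atTop_atTop.eventually_ge_atTop c).and (h3.eventually_le_const hη))).exists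
  exact ⟨ℓ, h.1, h.2.1, h.2.2⟩

lemma sum_range_block_rate_le {K ρ : ℝ} (hK : 0 ≤ K) (hρ0 : 0 < ρ) (hρ1 : ρ < 1) (A : ℝ)
    (ℓ n : ℕ) :
    ∑ q ∈ Finset.range n, A ^ 2 * ((if q = 0 then 5 / (2 * (ℓ : ℝ)) else 0) + K * ρ ^ ℓ * ρ ^ q)
      ≤ A ^ 2 * (5 / (2 * (ℓ : ℝ)) + K * ρ ^ ℓ * (1 - ρ)⁻¹) := by
  rw [← Finset.mul_sum, Finset.sum_add_distrib, ← Finset.mul_sum]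
  have h1 : ∑ q ∈ Finset.range n, (if q = 0 then 5 / (2 * (ℓ : ℝ)) else 0) ≤ 5 / (2 * (ℓ : ℝ)) := by
    rw [Finset.sum_ite_eq']
    split_ifs
    · exact le_rfl
    · positivity
  have h2 : ∑ q ∈ Finset.range n, ρ ^ q ≤ (1 - ρ)⁻¹ := by
    rw [← tsum_geometric_of_lt_one hρ0.le hρ1]
    exact (summable_geometric_of_lt_one hρ0.le hρ1).sum_le_tsum _ fun q _ => by positivity
  gcongr

end Main

theorem mainTheorem3 {Ω : Type*} [MeasurableSpace Ω] (P : Measure Ω) [IsProbabilityMeasure P]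
    {d : ℕ} (hd : 1 ≤ d) (X : ℕ → Ω → EuclideanSpace ℝ (Fin d))
    (hmeas : ∀ k, 1 ≤ k → Measurable (X k))
    (hbdd : ∃ L : ℝ, ∀ k, 1 ≤ k → ∀ᵐ ω ∂P, ‖X k ω‖ ≤ L)
    (hmean : ∀ k, 1 ≤ k → ∫ ω, X k ω ∂P = 0)
    (hα : ∃ C δ : ℝ, 0 < C ∧ 0 < δ ∧ δ < 1 ∧ ∀ n : ℕ, 1 ≤ n → alphaCoeff P X n ≤ C * δ ^ n)
    (hφ : ∃ n₀ : ℕ, 1 ≤ n₀ ∧ phiCoeff P X n₀ < 1 / 2)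
    (hcov : ComparableEigenvalues P X)
    (hs : Tendsto (fun n => minVar P X n) atTop atTop) :
    ∃ A₁ A₂ : ℝ, 0 < A₁ ∧ 0 < A₂ ∧ ∃ a b : ℕ → ℕ, IsBlockPartition a b ∧
      (∀ j, 1 ≤ j → ∀ u : EuclideanSpace ℝ (Fin d), ‖u‖ = 1 →
        A₁ ≤ lpNorm (fun ω => inner ℝ (segSum X (a j) (b j) ω) u) 2 P ∧
        ∀ m ∈ Finset.Icc (a j) (b j),
          lpNorm (fun ω => inner ℝ (segSum X (a j) m ω) u) 2 P ≤ A₂) ∧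
      (∃ c : ℝ, 0 < c ∧ ∀ j, 1 ≤ j → ∀ i ∈ Finset.Icc (a j) (b j),
        lpNorm (segSum X i (b j)) 2 P ≤ c) ∧
      (∃ R₁ R₂ : ℝ, 0 < R₁ ∧ 0 < R₂ ∧ ∀ᶠ n in atTop,
        ∀ u : EuclideanSpace ℝ (Fin d), ‖u‖ = 1 →
          R₁ * (blockCount b n : ℝ) ≤ variance (fun ω => inner ℝ (partialSum P X n ω) u) P ∧
          variance (fun ω => inner ℝ (partialSum P X n ω) u) P
            = quadForm (covMatrix P (partialSum P X n)) u ∧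
          variance (fun ω => inner ℝ (partialSum P X n ω) u) P ≤ R₂ * (blockCount b n : ℝ)) ∧
      (∀ ε : ℝ, 0 < ε → ∀ᵐ ω ∂P,
        (fun n : ℕ => partialSum P X n ω
            - ∑ j ∈ Finset.Icc 1 (blockCount b n), segSum X (a j) (b j) ω)
          =o[atTop] fun n : ℕ => minVar P X n ^ ε) := by
  obtain ⟨L', hL'⟩ := hbdd
  obtain ⟨C₀, δ, -, hδ0, hδ1, hα⟩ := hα
  obtain ⟨n₀, hn₀, hφ⟩ := hφ
  obtain ⟨C₁, C₂, -, hC₂, hcomp⟩ := hcov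
  obtain ⟨C, ρ, hC, hρ0, hρ1, hrate⟩ := exists_cube_rate (C := C₀) hδ0 hδ1
  have hα' : ∀ k, 1 ≤ k → alphaCoeff P X k ≤ (C * ρ ^ k) ^ 3 := fun k hk =>
    (hα k hk).trans (hrate k)
  -- Having `L ≥ 1` ensures `A = ℓ² L ≥ ℓ ≥ C₁`, so the eigenvalue comparison applies to every
  -- block.
  set L : ℝ := max L' 1 with hLdef
  have hL1 : 1 ≤ L := le_max_right _ _
  have hL0 : 0 < L := one_pos.trans_le hL1
  have hL : ∀ᵐ ω ∂P, ∀ k, 1 ≤ k → ‖X k ω‖ ≤ L := by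
    rw [ae_all_iff]
    intro k
    by_cases hk : 1 ≤ k
    · filter_upwards [hL' k hk] with ω hω _ using hω.trans (le_max_left _ _)
    · exact ae_of_all _ fun ω h => absurd h hk
  have hC₂0 : 0 < C₂ := one_pos.trans_le hC₂
  have hd0 : (0 : ℝ) < d := by exact_mod_cast hd
  have hκ := geomMoment_nonneg
  set K : ℝ := (5 + geomMoment) * (41 + 2 * n₀) ^ 2 * C with hK
  have hK0 : 0 ≤ K := by positivity
  obtain ⟨ℓ, hℓ2, hℓC, hσ⟩ := exists_block_parameter (K := K) (c := C₁) hρ0 hρ1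
    (show 0 < 1 / (4 * (d * C₂)) by positivity)
  have hℓ' : (2 : ℝ) ≤ ℓ := by exact_mod_cast hℓ2
  set A : ℝ := (ℓ : ℝ) ^ 2 * L with hA
  have hLA : L ≤ A := le_mul_of_one_le_left hL0.le (by nlinarith)
  have hA0 : 0 < A := hL0.trans_le hLA
  have hC₁A : C₁ ≤ A := by nlinarith
  obtain ⟨b, hb0, hbmono, hgreedy⟩ := exists_greedy_blocks
    (N := fun a m => lpNorm (segSum X a m) 2 P) (A := A)
    fun a ha => exists_le_lpNorm_segSum hmeas hL hmean hd hs A ha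
  have hblock : ∀ j m, m ≤ b (j + 1) → lpNorm (segSum X (b j + 1) m) 2 P ≤ A + L := fun j m hm =>
    lpNorm_segSum_le_of_first_crossing hmeas hL0.le hL hA0.le (by omega)
      (hbmono (Nat.lt_succ_self j)) (hgreedy j).2 hm
  have hseg : ∀ j, SegBound P X (2 * (A + L)) (b j + 1) (b (j + 1)) := fun j =>
    segBound_of_lpNorm_le hmeas hL (by omega) (hblock j)
  -- Reaching norm `ℓ² L` takes at least `ℓ²` summands of size at most `L`.
  have hlen : ∀ j, b j + ℓ ^ 2 ≤ b (j + 1) := by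
    intro j
    have h1 := (hgreedy j).1.trans
      (lpNorm_segSum_le (P := P) hmeas hL0.le hL (a := b j + 1) (b := b (j + 1)) (by omega))
    have h2 : ((ℓ ^ 2 : ℕ) : ℝ) ≤ ((b (j + 1) + 1 - (b j + 1) : ℕ) : ℝ) := by
      rw [Nat.cast_pow]
      exact le_of_mul_le_mul_right h1 hL0
    have h3 : ℓ ^ 2 ≤ b (j + 1) + 1 - (b j + 1) := by exact_mod_cast h2
    have h4 : b j < b (j + 1) := hbmono (Nat.lt_succ_self j)
    omega
  have hmem : ∀ {i m : ℕ}, 1 ≤ i → MemLp (segSum X i m) 2 P := fun hi =>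
    memLp_segSum hmeas hL hi 2
  set v : ℝ := A ^ 2 / (d * C₂) with hv
  have hv0 : 0 < v := by positivity
  have hlow : ∀ j (u : EuclideanSpace ℝ (Fin d)), ‖u‖ = 1 →
      v ≤ variance (fun ω => inner ℝ (segSum X (b j + 1) (b (j + 1)) ω) u) P := fun j u hu =>
    le_variance_inner_segSum hmeas hL hmean hd hA0.le hC₂0 (by omega)
      (hcomp _ _ (by omega) (hbmono (Nat.lt_succ_self j)) (hC₁A.trans (hgreedy j).1))
      (hgreedy j).1 hu
  have hup : ∀ j m (u : EuclideanSpace ℝ (Fin d)), m ≤ b (j + 1) → ‖u‖ = 1 →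
      variance (fun ω => inner ℝ (segSum X (b j + 1) m ω) u) P ≤ 4 * A ^ 2 := by
    intro j m u hm hu
    refine (variance_inner_le (hmem (by omega)) hu).trans ?_
    refine (pow_le_pow_left₀ lpNorm_nonneg (hblock j m hm) 2).trans ?_
    nlinarith
  have hvar : ∀ k (u : EuclideanSpace ℝ (Fin d)), ‖u‖ = 1 →
      v / 2 * k ≤ variance (fun ω => inner ℝ (segSum X 1 (b k) ω) u) P ∧
      variance (fun ω => inner ℝ (segSum X 1 (b k) ω) u) P ≤ (4 * A ^ 2 + v / 2) * k := by
    intro k u hu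
    -- The choice of `ℓ` makes the total covariance error `2 (v/4) k`, half of the diagonal lower
    -- bound `v k`.
    have hs2 : A ^ 2 * (5 / (2 * (ℓ : ℝ)) + K * ρ ^ ℓ * (1 - ρ)⁻¹) ≤ v / 4 := by
      refine (mul_le_mul_of_nonneg_left hσ (sq_nonneg A)).trans (le_of_eq ?_)
      rw [hv]; field_simp
    have h := abs_le.1 (abs_variance_sum_sub_le (P := P)
      (Z := fun j ω => inner ℝ (segSum X (b j + 1) (b (j + 1)) ω) u)
      (fun j => memLp_inner_left (hmem (by omega)) u)
      (fun n => (sum_range_block_rate_le hK0 hρ0 hρ1 A ℓ n).trans hs2)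
      (fun i q => abs_covariance_blocks_le hmeas hL0 hL hn₀ hφ hC hρ0 hα' hℓ2 hA hlen hblock hu
        i q) k)
    simp_rw [← sum_inner, sum_segSum_blocks X hbmono hb0] at h
    have h1 := Finset.card_nsmul_le_sum (Finset.range k) _ _ fun j _ => hlow j u hu
    have h2 := Finset.sum_le_card_nsmul (Finset.range k) _ _ fun j _ => hup j _ u le_rfl hu
    simp only [Finset.card_range, nsmul_eq_mul] at h1 h2
    constructor <;> linarith [h.1, h.2]
  have hpart : ∀ n, partialSum P X n = segSum X 1 n := partialSum_eq_segSum hmean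
  have hcount := tendsto_blockCount hbmono hb0
  have hquad : ∃ R₁ R₂ : ℝ, 0 < R₁ ∧ 0 < R₂ ∧ ∀ᶠ n in atTop,
      ∀ u : EuclideanSpace ℝ (Fin d), ‖u‖ = 1 →
        R₁ * (blockCount b n : ℝ) ≤ variance (fun ω => inner ℝ (partialSum P X n ω) u) P ∧
        variance (fun ω => inner ℝ (partialSum P X n ω) u) P
          = quadForm (covMatrix P (partialSum P X n)) u ∧
        variance (fun ω => inner ℝ (partialSum P X n ω) u) P ≤ R₂ * (blockCount b n : ℝ) := by
    -- The incomplete block has variance at most `4 A²`. The lower bound `(v/4) k - 4 A²` is at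
    -- least `(v/8) k` once `k ≥ 32 A² / v`; the upper bound absorbs the extra `8 A²` once `k ≥ 1`.
    refine ⟨v / 8, 16 * A ^ 2 + v, by positivity, by positivity, ?_⟩
    obtain ⟨k₀, hk₀⟩ := exists_nat_ge (32 * A ^ 2 / v)
    rw [div_le_iff₀ hv0] at hk₀
    filter_upwards [hcount.eventually_ge_atTop (max k₀ 1)] with n hn u hu
    have hn1 : (k₀ : ℝ) ≤ blockCount b n := by exact_mod_cast (le_max_left _ _).trans hn
    have hn2 : (1 : ℝ) ≤ blockCount b n := by exact_mod_cast (le_max_right _ _).trans hn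
    obtain ⟨hspec₁, hspec₂⟩ := blockCount_spec hbmono hb0 n
    have hsplit : (fun ω => (inner ℝ (segSum X 1 n ω) u : ℝ))
        = fun ω => inner ℝ (segSum X 1 (b (blockCount b n)) ω) u
          + inner ℝ (segSum X (b (blockCount b n) + 1) n ω) u := by
      ext ω
      rw [← inner_add_left, segSum_add_segSum (by omega) hspec₁]
    have h1 := variance_add_bounds (P := P)
      (memLp_inner_left (hmem (m := b (blockCount b n)) le_rfl) u)
      (memLp_inner_left (hmem (i := b (blockCount b n) + 1) (m := n) (by omega)) u)
    have h2 := hvar (blockCount b n) u hu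
    have h3 := hup (blockCount b n) n u hspec₂.le hu
    rw [← hsplit] at h1
    rw [hpart]
    refine ⟨?_, variance_inner_eq_quadForm (hmem le_rfl) u, ?_⟩
    · have h4 := mul_le_mul_of_nonneg_right hn1 hv0.le
      linarith [h1.1, h2.1]
    · have h4 := mul_le_mul_of_nonneg_left hn2 (sq_nonneg A)
      linarith [h1.2, h2.2]
  refine ⟨√v, A + L, Real.sqrt_pos.2 hv0, by positivity, fun j => b (j - 1) + 1, b,
    isBlockPartition_of_strictMono hbmono hb0, ?_, ⟨2 * (A + L), by positivity, ?_⟩, hquad, ?_⟩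
  · intro j hj u hu
    obtain ⟨j, rfl⟩ : ∃ i, j = i + 1 := ⟨j - 1, by omega⟩
    simp only [Nat.add_sub_cancel]
    refine ⟨?_, fun m hm => ?_⟩
    · refine Real.sqrt_le_iff.2 ⟨lpNorm_nonneg, ?_⟩
      rw [sq_lpNorm_inner (hmem (by omega)) (integral_segSum hmeas hL hmean (by omega))]
      exact hlow j u hu
    · exact (lpNorm_inner_le (hmem (by omega)) hu).trans (hblock j m (Finset.mem_Icc.1 hm).2)
  · intro j hj i hi
    obtain ⟨j, rfl⟩ : ∃ i, j = i + 1 := ⟨j - 1, by omega⟩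
    exact hseg j i _ (Finset.mem_Icc.1 hi).1 le_rfl
  · intro ε hε
    obtain ⟨R₁, R₂, hR₁, -, hR⟩ := hquad
    set W : ℝ := tailScale n₀ L (2 * (A + L)) with hW
    have hW0 : 0 ≤ W := by rw [hW]; unfold tailScale; positivity
    have hae := ae_eventually_notMem_exceedSet (P := P) (W := W)
      (E := fun j t => exceedSet X (b j + 1) (b (j + 1)) t)
      (fun j k => measureReal_exceedSet_nat_mul_le hmeas hL0.le hL hn₀ hφ (by positivity)
        (by omega) (hseg j) k)
    -- Once `k ≥ 1`, `k ≥ (k + 1)/2`, matching the argument `k + 1` of the logarithm in the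
    -- oscillation bound.
    have hmin : ∀ᶠ n in atTop, R₁ / 2 * ((blockCount b n : ℝ) + 1) ≤ minVar P X n := by
      filter_upwards [hR, hcount.eventually_ge_atTop 1] with n hn hn1
      have hn1' : (1 : ℝ) ≤ blockCount b n := by exact_mod_cast hn1
      have : Nonempty (Metric.sphere (0 : EuclideanSpace ℝ (Fin d)) 1) :=
        ⟨⟨EuclideanSpace.single (⟨0, hd⟩ : Fin d) (1 : ℝ), by simp⟩⟩
      refine le_ciInf fun u => ?_
      have h := hn u (by simp)
      rw [← h.2.1]
      nlinarith [h.1]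
    have hbig : (fun n : ℕ => ((blockCount b n : ℝ) + 1) ^ ε)
        =O[atTop] fun n : ℕ => minVar P X n ^ ε := by
      refine IsBigO.of_bound ((R₁ / 2) ^ ε)⁻¹ ?_
      filter_upwards [hmin] with n hn
      have h0 : 0 ≤ R₁ / 2 * ((blockCount b n : ℝ) + 1) := by positivity
      rw [Real.norm_of_nonneg (by positivity),
        Real.norm_of_nonneg (Real.rpow_nonneg (h0.trans hn) ε), le_inv_mul_iff₀ (by positivity),
        ← Real.mul_rpow (by positivity) (by positivity)]
      exact Real.rpow_le_rpow h0 hn hε.le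
    filter_upwards [hae] with ω hω
    refine IsBigO.trans_isLittleO (IsBigO.of_bound W ?_)
      (((ceil_log_isLittleO_rpow hε).comp_tendsto hcount).trans_isBigO hbig)
    filter_upwards [hcount.eventually hω] with n hn
    obtain ⟨hspec₁, hspec₂⟩ := blockCount_spec hbmono hb0 n
    rw [hpart, sum_Icc_segSum_blocks X hbmono hb0,
      ← segSum_add_segSum (m := b (blockCount b n)) (by omega) hspec₁ ω, add_sub_cancel_left,
      Function.comp_apply, Real.norm_of_nonneg (by positivity), mul_comm]
    -- The difference is a prefix sum of the block following the last complete one, so exceeding the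
    -- logarithmic bound would put `ω` in the excluded event.
    by_contra! hlt
    refine hn ⟨n, Finset.mem_Icc.2 ⟨?_, hspec₂.le⟩, hlt⟩
    by_contra! hlt'
    rw [segSum_of_lt hlt', Pi.zero_apply, norm_zero] at hlt
    exact absurd hlt (not_lt.2 (by positivity))
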